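/- Let $\mathcal D = e^{i\pi/4}2^{-1/2}\mathbb Z^2$ be the diamond graph, whose vertices on the horizontal axis are the points $(k,0)$, $k\in\mathbb Z$; we identify $k$ with $(k,0)$. For $s\ge 0$ let $\mathbf a=\mathbf a(s)$ be the following conductances on the nearest-neighbour edges of $\mathcal D$: an edge between the heights $\frac r2$ and $\frac{r+1}2$, or between $-\frac{r+1}2$ and $-\frac r2$ ($r\ge 0$ an integer), has conductance $a(r,r+1)$, where $a(0,1)=\frac14$ and $$\frac{a(r,r+1)}{a(r-1,r)+a(r,r+1)}=\Big(\frac12-\frac s{4r}\Big)\vee\frac14 ,\qquad r\ge 1 .$$ For $n\ge 1$ let $L_n=\{k\in\mathbb Z:\ |k|\ge n+1\}\times\{0\}$, and for a real $M\ge 1$ let $$H_n=H_n^{(M)}=\Big\{z\in\mathcal D\setminus L_n:\ \|z\|_\infty\le Mn,\ \operatorname{dist}_{\|\cdot\|_\infty}(z,L_n)\ge \tfrac1M n\Big\}.$$ Its boundary $\partial H_n$ consists of the points of $H_n$ with $\|z\|_\infty=Mn$ or $\operatorname{dist}_{\|\cdot\|_\infty}(z,L_n)=\frac1M n$. Let $G_{H_n,\mathbf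 a}(x,y)$ be the expected number of visits to $y$ of the random walk in the conductances $\mathbf a$ started at $x$ and killed when it first hits $\partial H_n$ (or leaves $H_n$, in case it jumps over $\partial H_n$); it is $0$ if $x$ or $y$ is not in $H_n\setminus\partial H_n$. **Proposition.** Let $s\in[0,1)$, $\delta>0$, $\epsilon>0$ and $M\ge1$. The Green function $G_{H_n,\mathbf a}(x,y)$ is finite for all $n\ge1$ and $x,y\in\mathbb Z$, and the following hold. 1. There is a constant $c=c(s,\delta,\epsilon,M)>0$ such that for all $n\ge 1$ and all integers $x,y$ with $|x|\le(1-\delta)n$ and $|y|\le(1-\frac\delta2)n$, $$|G_{H_n,\mathbf a}(x,y+1)-G_{H_n,\mathbf a}(x,y)|\le c\Big(\frac1{|x-y|+1}\Big)^{1-s-\epsilon}.$$ 2. There is a constant $c=c(s,\delta,\epsilon,M)>0$ such that for all $n\ge1$ and all integers $x,y$ with $|x|\le(1-\delta)n$ and $(1-\frac\delta2)n\le|y|\le n$, $$|G_{H_n,\mathbf a}(x,y+1)-G_{H_n,\mathbf a}(x,y)|\le c\Big(\frac1n\Big)^{1-s-\epsilon}.$$ 3. There is a constant $c=c(s,\delta,\epsilon,M)>0$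 such that for all $n\ge1$ and all integers $x$ with $|x|\le(1-\delta)n$, $$\sum_{i=-n}^{n}|G_{H_n,\mathbf a}(x,i+1)-G_{H_n,\mathbf a}(x,i)|^2\le c\sum_{k=1}^n\frac1{k^{2-2s-2\epsilon}} .$$ -/

import Mathlib

/-- Vertices of the diamond graph `e^{iπ/4} 2^{-1/2} ℤ²`: the pair `(a, b)` stands for the point
`e^{iπ/4} 2^{-1/2} (a + i b) = ((a - b) / 2, (a + b) / 2)` of the plane. -/
abbrev DiamondVertex := ℤ × ℤ

namespace Diamond

/-- The point of the plane represented by a vertex. The norm of `ℝ × ℝ` is the sup norm. -/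
noncomputable def position (z : DiamondVertex) : ℝ × ℝ :=
  (((z.1 : ℝ) - (z.2 : ℝ)) / 2, ((z.1 : ℝ) + (z.2 : ℝ)) / 2)

/-- The four nearest neighbours of a vertex (at displacement `(±1/2, ±1/2)` in the plane). -/
def neighbors (z : DiamondVertex) : Finset DiamondVertex :=
  {(z.1 + 1, z.2), (z.1 - 1, z.2), (z.1, z.2 + 1), (z.1, z.2 - 1)}

/-- The vertex at the integer point `(k, 0)` of the horizontal line. -/
def linePoint (k : ℤ) : DiamondVertex := (k, -k)

/-- The level of a vertex: twice its vertical coordinate, so that one step of the walk changes the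
level by `±1`. -/
def level (z : DiamondVertex) : ℤ := z.1 + z.2

/-- The probability `Q_s(r, r + 1)` that the discrete Bessel walk steps away from the origin from
height `r ≥ 1`. -/
noncomputable def besselUp (s : ℝ) (r : ℕ) : ℝ := max (1 / 2 - s / 4 * (1 / (r : ℝ))) (1 / 4)

/-- The conductance `a(r, r + 1)` of the edges between the levels `r` and `r + 1`, for `r ≥ 0`:
`a(0, 1) = 1/4`, and `a(r, r + 1) / (a(r - 1, r) + a(r, r + 1)) = Q_s(r, r + 1)` for `r ≥ 1`
(see `levelConductance_ratio`). -/
noncomputable def levelConductance (s : ℝ) : ℕ → ℝ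
  | 0 => 1 / 4
  | r + 1 => besselUp s (r + 1) / (1 - besselUp s (r + 1)) * levelConductance s r

theorem besselUp_pos (s : ℝ) (r : ℕ) : 0 < besselUp s r :=
  lt_of_lt_of_le (by norm_num) (le_max_right _ _)

theorem besselUp_lt_one {s : ℝ} (hs : 0 ≤ s) (r : ℕ) : besselUp s r < 1 := by
  have h : 0 ≤ s / 4 * (1 / (r : ℝ)) := by positivity
  exact max_lt (by linarith) (by norm_num)

theorem levelConductance_pos {s : ℝ} (hs : 0 ≤ s) (r : ℕ) : 0 < levelConductance s r := by
  induction r with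
  | zero => norm_num [levelConductance]
  | succ r ih =>
    have h1 := besselUp_pos s (r + 1)
    have h2 : 0 < 1 - besselUp s (r + 1) := by linarith [besselUp_lt_one hs (r + 1)]
    simp only [levelConductance]
    positivity

theorem levelConductance_ratio {s : ℝ} (hs : 0 ≤ s) (r : ℕ) :
    levelConductance s (r + 1) / (levelConductance s r + levelConductance s (r + 1))
      = besselUp s (r + 1) := by
  have h1 := levelConductance_pos hs r
  have h2 : 0 < 1 - besselUp s (r + 1) := by linarith [besselUp_lt_one hs (r + 1)]
  simp only [levelConductance]
  field_simp
  ring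

/-- The conductance of the edge between two neighbouring vertices, symmetric under the reflection
in the horizontal line: an edge between the levels `r` and `r + 1`, or between `-r - 1` and `-r`,
`r ≥ 0`, carries `a(r, r + 1)`. -/
noncomputable def conductance (s : ℝ) (z w : DiamondVertex) : ℝ :=
  levelConductance s (min (level z).natAbs (level w).natAbs)

/-- The probability that the random walk in the conductances `a(s)` steps from `z` to its
neighbour `w`. -/
noncomputable def stepProb (s : ℝ) (z w : DiamondVertex) : ℝ :=
  conductance s z w / ∑ v ∈ neighbors z, conductance s z v

open Classical in
/-- The probability, for the random walk in the conductances `a(s)` started at `x`, that the walk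
is at `y` at time `t` and lies in `U` at all the times `0, …, t`. -/
noncomputable def survivalProb (s : ℝ) (U : Set DiamondVertex) :
    ℕ → DiamondVertex → DiamondVertex → ℝ
  | 0, x, y => if x ∈ U ∧ x = y then 1 else 0
  | t + 1, x, y =>
    if x ∈ U then ∑ w ∈ neighbors x, stepProb s x w * survivalProb s U t w y else 0

/-- The expected number of visits to `y` of the random walk in the conductances `a(s)` started at
`x` and killed at the first time it is not in `U`. -/
noncomputable def green (s : ℝ) (U : Set DiamondVertex) (x y : DiamondVertex) : ℝ :=
  ∑' t : ℕ, survivalProb s U t x y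

/-- The slit `L_n = ({…, -n - 1} ∪ {n + 1, …}) × {0}`. -/
def slit (n : ℕ) : Set DiamondVertex := linePoint '' {k : ℤ | (n : ℤ) + 1 ≤ |k|}

/-- The distance of a vertex to the slit `L_n` in the sup norm of the plane. -/
noncomputable def distSlit (n : ℕ) (z : DiamondVertex) : ℝ :=
  Metric.infDist (position z) (position '' slit n)

/-- The smoothed domain `H_n = H_n^{(M)}`: the vertices outside the slit, of sup norm at most
`M n`, at sup distance at least `n / M` from the slit. -/
def smoothDomain (n : ℕ) (M : ℝ) : Set DiamondVertex :=
  {z | z ∉ slit n ∧ ‖position z‖ ≤ M * n ∧ 1 / M * n ≤ distSlit n z}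

/-- The boundary of the smoothed domain: its points on the square of radius `M n`, and its points
at distance `n / M` from the slit. -/
def smoothBoundary (n : ℕ) (M : ℝ) : Set DiamondVertex :=
  {z | z ∈ smoothDomain n M ∧ (‖position z‖ = M * n ∨ distSlit n z = 1 / M * n)}

/-- The vertices at which the walk in the smoothed domain is alive. A walk starting there is killed
when it hits the boundary, or when it jumps over it because `M n` or `n / M` is not a
half-integer. -/
def liveDomain (n : ℕ) (M : ℝ) : Set DiamondVertex := smoothDomain n M \ smoothBoundary n M

/-- The Green function `G_{H_n, a}(x, y)` of the smoothed domain `H_n = H_n^{(M)}`, for the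
points `x` and `y` of the line. -/
noncomputable def lineGreen (s M : ℝ) (n : ℕ) (x y : ℤ) : ℝ :=
  green s (liveDomain n M) (linePoint x) (linePoint y)

end Diamond

/-! In the coordinates `(h, v)` (twice the horizontal coordinate, and the level) a step of the walk
moves `h` and `v` independently: `h` performs simple random walk and `v` a walk with drift towards
level zero. Killing in the strip `|h| < gapWidth` inside the box depends on `v` alone, so there the
Green function factorises. Decomposing at the exit time from the strip (`gridGreen_line_eq`) writes
the Green function on the line as a bulk sum of horizontal heat kernels times vertical return
probabilities, plus boundary terms carrying the values on the lines `h = ±gapWidth`. All estimates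
are made up to a finite time and uniformly in it.

Bulk sum. The return probabilities are at most of order `k ^ (-(1 - s) / 2)` (`returnBound_le`), by
a local time computation with the scale function, and they decrease along even times. Decompose the
horizontal gradient at the hitting time of the target: the partial sums of the gradient at the pole
lie in `[-4, 0]`, so summation by parts bounds its sum against an antitone sequence by four times
the weight at the hitting time. The hitting time is of order the squared distance, which gives `|x -
y| ^ (s - 1)` (`abs_sum_mul_heat_sub_le`). Summing this gradient across a domain of width `L` also
bounds the Green function itself by `L ^ b` for `b ≥ s`, `b > 0` (`gridGreen_le`).

Boundary terms. Mirror coupling shows that the gradient of the exit time distribution has total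
variation of order `T ^ (-1/2)` beyond time `T` (`sum_abs_evolve_single_sub_le`). The boundary
values vanish near level zero because the slit is thickened, so by Chebyshev their vertical average
at exit time `k` is at most `F * min 1 (k / m)`, with `F` of order `n ^ b` and `m` of order `(n / M)
^ 2` (`vertStep_pow_gridGreen_le`). Together these give `F * m ^ (-1/2)`, of order `n ^ (b - 1)`,
which the bulk rate absorbs since `|x - y| ≤ 2 n`.

The resulting bound holds up to `|y| = n` (`abs_lineGreen_sub_le`); all three gradient estimates
follow from it. -/

namespace SlitWalk
open Finset

/-! ### Simple random walk killed outside an interval, and the exit decomposition. -/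

/-- The evolution of `g` under simple random walk, killed outside the open interval `(lo, hi)` from
time one on. -/
noncomputable def evolve (lo hi : ℤ) (g : ℤ → ℝ) : ℕ → ℤ → ℝ
  | 0, x => g x
  | k + 1, x =>
    if lo < x ∧ x < hi then (evolve lo hi g k (x - 1) + evolve lo hi g k (x + 1)) / 2 else 0

/-- The transition probabilities of simple random walk killed outside `(lo, hi)`. -/
noncomputable def heat (lo hi : ℤ) : ℕ → ℤ → ℤ → ℝ
  | 0, x, w => if lo < x ∧ x < hi ∧ x = w then 1 else 0
  | k + 1, x, w =>
    if lo < x ∧ x < hi then (heat lo hi k (x - 1) w + heat lo hi k (x + 1) w) / 2 else 0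

variable {lo hi : ℤ}

theorem heat_nonneg (k : ℕ) (x w : ℤ) : 0 ≤ heat lo hi k x w := by
  induction k generalizing x with
  | zero => simp only [heat]; split_ifs <;> norm_num
  | succ k ih =>
    simp only [heat]
    split_ifs
    · have := ih (x - 1); have := ih (x + 1); positivity
    · exact le_rfl

theorem heat_eq_zero_left (k : ℕ) {x : ℤ} (w : ℤ) (hx : ¬(lo < x ∧ x < hi)) :
    heat lo hi k x w = 0 := by
  cases k with
  | zero => simp only [heat]; rw [if_neg]; tauto
  | succ k => simp only [heat]; rw [if_neg hx]

theorem heat_succ_right (k : ℕ) (x w : ℤ) : heat lo hi (k + 1) x w =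
    if lo < w ∧ w < hi then (heat lo hi k x (w - 1) + heat lo hi k x (w + 1)) / 2 else 0 := by
  induction k generalizing x with
  | zero =>
    simp only [heat]
    grind
  | succ k ih =>
    rw [heat, ih, ih]
    by_cases hx : lo < x ∧ x < hi <;> by_cases hw : lo < w ∧ w < hi
    · rw [if_pos hx, if_pos hw, if_pos hw, if_pos hw]
      simp only [heat]
      rw [if_pos hx, if_pos hx]; ring
    · simp [hw]
    · rw [if_neg hx, if_pos hw, heat_eq_zero_left _ _ hx, heat_eq_zero_left _ _ hx]; norm_num
    · simp [hw]

theorem heat_comm (k : ℕ) (x w : ℤ) : heat lo hi k x w = heat lo hi k w x := by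
  induction k generalizing x w with
  | zero => simp only [heat]; grind
  | succ k ih => rw [heat_succ_right, heat, ih x, ih x]

theorem heat_neg (N : ℤ) (k : ℕ) (x w : ℤ) : heat (-N) N k (-x) (-w) = heat (-N) N k x w := by
  induction k generalizing x with
  | zero => simp only [heat]; grind
  | succ k ih =>
    have h1 := ih (x - 1)
    have h2 := ih (x + 1)
    rw [show -(x - 1) = -x + 1 by ring] at h1
    rw [show -(x + 1) = -x - 1 by ring] at h2
    simp only [heat]
    rw [h1, h2, add_comm]
    congr 1
    grind

/-- Parity of the walk. Between even points only even times count, so the return probabilities,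
monotone only along even times, can be replaced by an antitone sequence. -/
theorem heat_eq_zero_of_odd (k : ℕ) {x w : ℤ} (h : Odd (k + x + w)) : heat lo hi k x w = 0 := by
  induction k generalizing x with
  | zero =>
    simp only [heat]
    rw [if_neg]
    rintro ⟨-, -, rfl⟩
    obtain ⟨m, hm⟩ := h
    push_cast at hm
    omega
  | succ k ih =>
    have h1 : Odd ((k : ℤ) + (x - 1) + w) := by
      push_cast at h; rw [show (k : ℤ) + (x - 1) + w = (k + 1 + x + w) - 2 by ring]
      exact h.sub_even even_two
    have h2 : Odd ((k : ℤ) + (x + 1) + w) := by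
      push_cast at h; rw [show (k : ℤ) + (x + 1) + w = k + 1 + x + w by ring]; exact h
    simp [heat, ih h1, ih h2]

theorem evolve_nonneg {g : ℤ → ℝ} (hg : ∀ x, 0 ≤ g x) (k : ℕ) (x : ℤ) :
    0 ≤ evolve lo hi g k x := by
  induction k generalizing x with
  | zero => exact hg x
  | succ k ih =>
    simp only [evolve]
    split_ifs
    · have := ih (x - 1); have := ih (x + 1); positivity
    · exact le_rfl

theorem evolve_succ_of_not_mem {x : ℤ} (g : ℤ → ℝ) (k : ℕ) (hx : ¬(lo < x ∧ x < hi)) :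
    evolve lo hi g (k + 1) x = 0 := by
  simp only [evolve]; rw [if_neg hx]

theorem evolve_succ_of_mem {x : ℤ} (g : ℤ → ℝ) (k : ℕ) (hx : lo < x ∧ x < hi) :
    evolve lo hi g (k + 1) x = (evolve lo hi g k (x - 1) + evolve lo hi g k (x + 1)) / 2 := by
  simp only [evolve]; rw [if_pos hx]

theorem evolve_evolve (g : ℤ → ℝ) (j k : ℕ) (x : ℤ) :
    evolve lo hi (evolve lo hi g j) k x = evolve lo hi g (j + k) x := by
  induction k generalizing x with
  | zero => rfl
  | succ k ih => rw [← add_assoc]; simp only [evolve, ih]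

theorem evolve_sum {ι : Type*} (I : Finset ι) (c : ι → ℝ) (g : ι → ℤ → ℝ) (k : ℕ) (x : ℤ) :
    evolve lo hi (fun z => ∑ i ∈ I, c i * g i z) k x = ∑ i ∈ I, c i * evolve lo hi (g i) k x := by
  induction k generalizing x with
  | zero => rfl
  | succ k ih =>
    simp only [evolve, ih]
    split_ifs
    · rw [← sum_add_distrib, sum_div]
      exact sum_congr rfl fun i _ => by ring
    · simp

/-- The total mass of the hitting distribution of a boundary point is at most one. -/
theorem sum_evolve_single_le_one {w : ℤ} (hw : ¬(lo < w ∧ w < hi)) (T : ℕ) (x : ℤ) :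
    ∑ k ∈ range (T + 1), evolve lo hi (Pi.single w 1) k x ≤ 1 := by
  induction T generalizing x with
  | zero => simp only [zero_add, sum_range_one, evolve, Pi.single_apply]; split_ifs <;> norm_num
  | succ T ih =>
    rw [sum_range_succ']
    by_cases hx : lo < x ∧ x < hi
    · have hxw : x ≠ w := by rintro rfl; exact hw hx
      simp only [evolve, if_pos hx, Pi.single_apply, if_neg hxw, add_zero]
      rw [← sum_div, sum_add_distrib]
      linarith [ih (x - 1), ih (x + 1)]
    · rw [sum_eq_zero fun k _ => evolve_succ_of_not_mem _ k hx]
      simp only [evolve, Pi.single_apply]; split_ifs <;> norm_num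

/-- Decomposition of a solution of the inhomogeneous evolution equation at the exit from an
interval. -/
theorem eq_sum_heat_add_sum_evolve {E : Type*} [AddCommGroup E] [Module ℝ E] (Q : E →ₗ[ℝ] E)
    (src : E) (x : ℤ) (F : ℕ → ℤ → E) (hlt : lo < hi)
    (h0 : ∀ h, lo < h → h < hi → F 0 h = if h = x then src else 0)
    (hs : ∀ T h, lo < h → h < hi → F (T + 1) h =
      (if h = x then src else 0) + (1 / 2 : ℝ) • Q (F T (h - 1) + F T (h + 1)))
    (T : ℕ) (h : ℤ) (hlo : lo ≤ h) (hhi : h ≤ hi) :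
    F T h = ∑ k ∈ range (T + 1), (heat lo hi k h x • (Q ^ k) src
      + evolve lo hi (Pi.single lo 1) k h • (Q ^ k) (F (T - k) lo)
      + evolve lo hi (Pi.single hi 1) k h • (Q ^ k) (F (T - k) hi)) := by
  induction T generalizing h with
  | zero =>
    rcases hlo.eq_or_lt with rfl | hlo
    · simp [heat, evolve, hlt.ne]
    rcases hhi.eq_or_lt with rfl | hhi
    · simp [heat, evolve, hlt.ne']
    simp [heat, evolve, hlo.ne', hhi.ne, h0 h hlo hhi, hlo, hhi]
  | succ T ih =>
    rw [sum_range_succ']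
    -- At an endpoint only the term `k = 0` survives: the indicator is one there at time zero and is
    -- killed from time one on.
    rcases hlo.eq_or_lt with rfl | hlo'
    · rw [sum_eq_zero fun k _ => ?_]
      · simp [heat, evolve, hlt.ne]
      · simp [heat, evolve]
    rcases hhi.eq_or_lt with rfl | hhi'
    · rw [sum_eq_zero fun k _ => ?_]
      · simp [heat, evolve, hlt.ne']
      · simp [heat, evolve]
    rw [hs T h hlo' hhi', ih (h - 1) (by omega) (by omega), ih (h + 1) (by omega) (by omega),
      ← sum_add_distrib, map_sum, smul_sum, add_comm]
    congr 1
    · refine sum_congr rfl fun k _ => ?_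
      simp only [heat, evolve, if_pos (And.intro hlo' hhi'), map_add, map_smul, pow_succ',
        Module.End.mul_apply, Nat.add_sub_add_right]
      module
    · simp [heat, evolve, hlo'.ne', hhi'.ne, hlo', hhi']

/-! ### Gradient of the one-dimensional Green function with antitone time weights. -/

theorem sum_heat_succ (R : ℕ) (z y : ℤ) : ∑ r ∈ range (R + 2), heat lo hi r z y =
    heat lo hi 0 z y + if lo < z ∧ z < hi then
      (∑ r ∈ range (R + 1), heat lo hi r (z - 1) y
        + ∑ r ∈ range (R + 1), heat lo hi r (z + 1) y) / 2 else 0 := by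
  rw [sum_range_succ', add_comm]
  congr 1
  simp only [heat]
  split_ifs
  · rw [← sum_add_distrib, sum_div]
  · simp

/-- Maximum principle: away from the pole, the sum is an average of neighbouring sums over a shorter
time, or zero. -/
theorem sum_heat_le_diag (R : ℕ) (z : ℤ) {y : ℤ} (hy : lo < y ∧ y < hi) :
    ∑ r ∈ range (R + 1), heat lo hi r z y ≤ ∑ r ∈ range (R + 1), heat lo hi r y y := by
  induction R generalizing z with
  | zero => simp only [zero_add, sum_range_one, heat]; grind
  | succ R ih =>
    by_cases hz : z = y
    · rw [hz]
    have hmono : ∑ r ∈ range (R + 1), heat lo hi r y y ≤ ∑ r ∈ range (R + 2), heat lo hi r y y := by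
      rw [sum_range_succ _ (R + 1)]; linarith [heat_nonneg (lo := lo) (hi := hi) (R + 1) y y]
    rw [sum_heat_succ]
    have h0 : heat lo hi 0 z y = 0 := by simp only [heat]; grind
    have hpos : 0 ≤ ∑ r ∈ range (R + 1), heat lo hi r y y := sum_nonneg fun r _ => heat_nonneg r y y
    have := ih (z - 1)
    have := ih (z + 1)
    split_ifs <;> linarith

/-- The Green function up to a time has a bounded gradient next to its pole. -/
theorem sum_heat_diag_sub_le (R : ℕ) {y : ℤ} (hy : lo < y ∧ y < hi) :
    ∑ r ∈ range (R + 1), heat lo hi r y y - ∑ r ∈ range (R + 1), heat lo hi r (y + 2) y ≤ 4 := by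
  set S : ℤ → ℝ := fun z => ∑ r ∈ range (R + 1), heat lo hi r z y with hS
  have hSn : ∀ z, 0 ≤ S z := fun z => sum_nonneg fun r _ => heat_nonneg r z y
  have hnb : ∀ z, z ≠ y →
      ∑ r ∈ range (R + 2), heat lo hi r z y ≤ (S (z - 1) + S (z + 1)) / 2 := by
    intro z hz
    rw [sum_heat_succ]
    have h0 : heat lo hi 0 z y = 0 := by simp only [heat]; grind
    have := hSn (z - 1)
    have := hSn (z + 1)
    rw [h0]
    split_ifs
    · simp [hS]
    · linarith
  have h1 := hnb (y - 1) (by omega)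
  have h2 := hnb (y + 1) (by omega)
  have h3 := sum_heat_succ (lo := lo) (hi := hi) (R + 1) y y
  rw [if_pos hy, show heat lo hi 0 y y = 1 by simp [heat, hy]] at h3
  have h4 : S y ≤ ∑ r ∈ range (R + 1 + 2), heat lo hi r y y := by
    rw [sum_range_succ, sum_range_succ]
    have := heat_nonneg (lo := lo) (hi := hi) (R + 1) y y
    have := heat_nonneg (lo := lo) (hi := hi) (R + 1 + 1) y y
    simp only [hS]; linarith
  have h5 : S (y - 1 - 1) ≤ S y := sum_heat_le_diag R _ hy
  rw [show y - 1 + 1 = y by ring] at h1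
  rw [show y + 1 - 1 = y by ring, show y + 1 + 1 = y + 2 by ring] at h2
  change S y - S (y + 2) ≤ 4
  simp only [show R + 1 + 1 = R + 2 from rfl] at h3
  -- Two steps of the recursion give `S y ≤ 1 + (S (y - 2) + 2 * S y + S (y + 2)) / 4`; with `S (y -
  -- 2) ≤ S y` this leaves a quarter of the gradient on the left, hence the constant 4.
  linarith

/-- Summation by parts against an antitone sequence. -/
theorem abs_sum_mul_le_of_antitone {r b : ℕ → ℝ} {C : ℝ} (hr : Antitone r) (hr0 : ∀ k, 0 ≤ r k)
    (hlow : ∀ R, -C ≤ ∑ i ∈ range R, b i) (hup : ∀ R, ∑ i ∈ range R, b i ≤ 0) (R : ℕ) :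
    |∑ i ∈ range R, r i * b i| ≤ C * r 0 := by
  -- The sum minus its Abel boundary term has increments equal to a decrement of `r` times a partial
  -- sum of `b`, so both bounds pass through the induction.
  have key : -(C * (r 0 - r R)) ≤ ∑ i ∈ range R, r i * b i - r R * ∑ i ∈ range R, b i ∧
      ∑ i ∈ range R, r i * b i - r R * ∑ i ∈ range R, b i ≤ 0 := by
    induction R with
    | zero => simp
    | succ R ih =>
      have hd : 0 ≤ r R - r (R + 1) := sub_nonneg.2 (hr (Nat.le_succ R))
      have e : ∑ i ∈ range (R + 1), r i * b i - r (R + 1) * ∑ i ∈ range (R + 1), b i =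
          (∑ i ∈ range R, r i * b i - r R * ∑ i ∈ range R, b i)
            + (r R - r (R + 1)) * ∑ i ∈ range (R + 1), b i := by
        rw [sum_range_succ, sum_range_succ]; ring
      have h1 := mul_le_mul_of_nonneg_left (hlow (R + 1)) hd
      have h2 := mul_le_mul_of_nonneg_left (hup (R + 1)) hd
      rw [e]
      constructor <;> linarith [ih.1, ih.2]
  have h1 := mul_le_mul_of_nonneg_left (hlow R) (hr0 R)
  have h2 := mul_le_mul_of_nonneg_left (hup R) (hr0 R)
  have hC : 0 ≤ C := by have := hlow 0; simp at this; exact this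
  rw [abs_le]
  constructor <;> nlinarith [mul_nonneg hC (hr0 0), key.1, key.2]

/-- A bound for `E [1 / (i + 1 + T)]`, with `T` the hitting time of `hi`. -/
theorem sum_evolve_single_div_le (T i : ℕ) (x : ℤ) (hx : x ≤ hi) :
    ∑ j ∈ range (T + 1), evolve lo hi (Pi.single hi 1) j x / ((i : ℝ) + 1 + j)
      ≤ 1 / ((i : ℝ) + 1 + ((hi : ℝ) - x) ^ 2 / 4) := by
  induction T generalizing i x with
  | zero =>
    simp only [zero_add, sum_range_one, evolve, Pi.single_apply]
    split_ifs with h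
    · simp [h]
    · simp only [zero_div]; positivity
  | succ T ih =>
    rw [sum_range_succ']
    by_cases hx' : lo < x ∧ x < hi
    · have hxw : x ≠ hi := hx'.2.ne
      simp only [evolve, if_pos hx', Pi.single_apply, if_neg hxw, zero_div, add_zero]
      have h1 := ih (i + 1) (x - 1) (by omega)
      have h2 := ih (i + 1) (x + 1) (by omega)
      have e : ∑ k ∈ range (T + 1), ((evolve lo hi (Pi.single hi 1) k (x - 1)
            + evolve lo hi (Pi.single hi 1) k (x + 1)) / 2) / ((i : ℝ) + 1 + ((k + 1 : ℕ) : ℝ))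
          = (∑ k ∈ range (T + 1), evolve lo hi (Pi.single hi 1) k (x - 1)
              / (((i + 1 : ℕ) : ℝ) + 1 + k)
            + ∑ k ∈ range (T + 1), evolve lo hi (Pi.single hi 1) k (x + 1)
              / (((i + 1 : ℕ) : ℝ) + 1 + k)) / 2 := by
        rw [← sum_add_distrib, sum_div]
        refine sum_congr rfl fun k _ => ?_
        rw [show ((i : ℝ) + 1 + ((k + 1 : ℕ) : ℝ)) = (((i + 1 : ℕ) : ℝ) + 1 + k) by
          push_cast; ring]
        ring
      rw [e]
      refine (div_le_div_of_nonneg_right (add_le_add h1 h2) (by norm_num)).trans ?_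
      push_cast
      set d : ℝ := (hi : ℝ) - x with hd
      have hd1 : 1 ≤ d := by
        have : (x : ℝ) + 1 ≤ hi := by exact_mod_cast hx'.2
        linarith
      rw [show (hi : ℝ) - (x - 1) = d + 1 by rw [hd]; ring,
        show (hi : ℝ) - (x + 1) = d - 1 by rw [hd]; ring]
      have hi0 : (0 : ℝ) ≤ i := Nat.cast_nonneg i
      -- The right side is a space-time supermartingale: with `A` the mean of the two denominators,
      -- the inequality reduces to `d ^ 2 ≤ 5 * A`, and `A ≥ d ^ 2 / 4`.
      rw [div_add_div _ _ (by positivity) (by positivity), div_div,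
        div_le_div_iff₀ (by positivity) (by positivity)]
      nlinarith [mul_nonneg hi0 hi0, mul_nonneg hi0 (sq_nonneg d), sq_nonneg d]
    · rw [sum_eq_zero fun k _ => by rw [evolve_succ_of_not_mem _ k hx', zero_div]]
      simp only [evolve, Pi.single_apply]
      split_ifs with h
      · simp [h]
      · simp only [zero_div, zero_add]; positivity

/-- Concavity of `u ↦ u ^ a`: its tangent at `1 / β` reduces the moment to the one of order one and
the total mass. Both coefficients of the tangent are nonnegative, so mass at most one suffices. -/
theorem sum_evolve_single_rpow_le {a : ℝ} (ha0 : 0 ≤ a) (ha1 : a ≤ 1) (T : ℕ) (x : ℤ)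
    (hx : x ≤ hi) :
    ∑ j ∈ range (T + 1), evolve lo hi (Pi.single hi 1) j x * ((j : ℝ) + 1) ^ (-a)
      ≤ (1 + ((hi : ℝ) - x) ^ 2 / 4) ^ (-a) := by
  set β : ℝ := 1 + ((hi : ℝ) - x) ^ 2 / 4 with hβ
  have hβ0 : 0 < β := by positivity
  set τ : ℕ → ℝ := fun j => evolve lo hi (Pi.single hi 1) j x with hτ
  have hτ0 : ∀ j, 0 ≤ τ j := fun j => evolve_nonneg
    (fun z => by simp only [Pi.single_apply]; split_ifs <;> norm_num) j x
  have hsum1 : ∑ j ∈ range (T + 1), τ j ≤ 1 := sum_evolve_single_le_one (by omega) T x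
  have hsum2 : ∑ j ∈ range (T + 1), τ j / ((j : ℝ) + 1) ≤ 1 / β := by
    have := sum_evolve_single_div_le (lo := lo) T 0 x hx
    simp only [Nat.cast_zero, zero_add] at this
    simpa [hτ, hβ, add_comm] using this
  have hpt : ∀ j : ℕ, ((j : ℝ) + 1) ^ (-a) ≤ β ^ (-a) * (a * β * (1 / ((j : ℝ) + 1)) + (1 - a)) := by
    intro j
    have hj : (0 : ℝ) < (j : ℝ) + 1 := by positivity
    have h := Real.geom_mean_le_arith_mean2_weighted ha0 (sub_nonneg.2 ha1)
      (show 0 ≤ β * (1 / ((j : ℝ) + 1)) by positivity) zero_le_one (by ring)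
    rw [Real.one_rpow, mul_one, Real.mul_rpow hβ0.le (by positivity), one_div,
      Real.inv_rpow hj.le, ← Real.rpow_neg hj.le] at h
    calc ((j : ℝ) + 1) ^ (-a) = β ^ (-a) * (β ^ a * ((j : ℝ) + 1) ^ (-a)) := by
          rw [← mul_assoc, ← Real.rpow_add hβ0]; simp
      _ ≤ _ := by
          refine mul_le_mul_of_nonneg_left (h.trans (le_of_eq ?_)) (by positivity)
          rw [one_div]; ring
  calc ∑ j ∈ range (T + 1), τ j * ((j : ℝ) + 1) ^ (-a)
      ≤ ∑ j ∈ range (T + 1), τ j * (β ^ (-a) * (a * β * (1 / ((j : ℝ) + 1)) + (1 - a))) :=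
        sum_le_sum fun j _ => mul_le_mul_of_nonneg_left (hpt j) (hτ0 j)
    _ = β ^ (-a) * (a * β * ∑ j ∈ range (T + 1), τ j / ((j : ℝ) + 1)
          + (1 - a) * ∑ j ∈ range (T + 1), τ j) := by
        rw [mul_sum, mul_sum, ← sum_add_distrib, mul_sum]
        exact sum_congr rfl fun j _ => by ring
    _ ≤ β ^ (-a) * (a * β * (1 / β) + (1 - a) * 1) := by
        refine mul_le_mul_of_nonneg_left (add_le_add ?_ ?_) (by positivity)
        · exact mul_le_mul_of_nonneg_left hsum2 (by positivity)
        · exact mul_le_mul_of_nonneg_left hsum1 (by linarith)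
    _ = β ^ (-a) := by field_simp; ring

/-- Decomposition at the first visit to `y`: a walk started on the left meets `y` before `y + 2`,
and nothing is contributed by the exit at `lo`. -/
theorem heat_sub_eq_sum {y : ℤ} (hy : lo < y) (hy' : y < hi) (k : ℕ) (x : ℤ) (hx : lo ≤ x)
    (hxy : x ≤ y) :
    heat lo hi k x (y + 2) - heat lo hi k x y = ∑ j ∈ range (k + 1),
      evolve lo y (Pi.single y 1) j x
        * (heat lo hi (k - j) y (y + 2) - heat lo hi (k - j) y y) := by
  have h := eq_sum_heat_add_sum_evolve (lo := lo) (hi := y) (LinearMap.id : ℝ →ₗ[ℝ] ℝ) 0 y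
    (fun k z => heat lo hi k z (y + 2) - heat lo hi k z y) hy
    (fun z h1 h2 => by simp only [heat]; grind)
    (fun T z h1 h2 => by
      simp only [heat, if_pos (And.intro h1 (h2.trans hy'))]
      simp; ring) k x hx hxy
  simp only [smul_eq_mul, map_zero, mul_zero, zero_add] at h
  rw [h]
  refine sum_congr rfl fun j _ => ?_
  rw [heat_eq_zero_left (x := lo) _ _ (by omega), heat_eq_zero_left (x := lo) _ _ (by omega)]
  rw [show (LinearMap.id : ℝ →ₗ[ℝ] ℝ) ^ j = LinearMap.id from one_pow j]
  simp

/-- The gradient of the Green function weighted by an antitone sequence, to the right of the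
starting point. -/
theorem abs_sum_mul_heat_sub_le_of_le {r : ℕ → ℝ} {K a : ℝ} (hr : Antitone r) (hr0 : ∀ k, 0 ≤ r k)
    (ha0 : 0 ≤ a) (ha1 : a ≤ 1) (hK : ∀ k : ℕ, r k ≤ K * ((k : ℝ) + 1) ^ (-a)) (T : ℕ) {x y : ℤ}
    (hxy : x ≤ y) :
    |∑ k ∈ range (T + 1), r k * (heat lo hi k x (y + 2) - heat lo hi k x y)|
      ≤ 4 * K * (1 + ((y : ℝ) - x) ^ 2 / 4) ^ (-a) := by
  have hK0 : 0 ≤ K := by simpa using (hr0 0).trans (hK 0)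
  by_cases hx : lo < x ∧ x < hi
  swap
  · rw [sum_eq_zero fun k _ => by rw [heat_eq_zero_left k _ hx, heat_eq_zero_left k _ hx]; ring]
    simp only [abs_zero]; positivity
  by_cases hy : y < hi
  swap
  · rw [sum_eq_zero fun k _ => by
      rw [heat_comm k x, heat_comm k x, heat_eq_zero_left k _ (by omega),
        heat_eq_zero_left k _ (by omega)]; ring]
    simp only [abs_zero]; positivity
  have hy' : lo < y ∧ y < hi := ⟨by omega, hy⟩
  set τ : ℕ → ℝ := fun j => evolve lo y (Pi.single y 1) j x with hτ
  have hτ0 : ∀ j, 0 ≤ τ j := fun j => evolve_nonneg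
    (fun z => by simp only [Pi.single_apply]; split_ifs <;> norm_num) j x
  set b : ℕ → ℝ := fun i => heat lo hi i y (y + 2) - heat lo hi i y y with hb
  -- Reordered by the hitting time `j` of `y` and the time `i` elapsed since then.
  have e : ∑ k ∈ range (T + 1), r k * (heat lo hi k x (y + 2) - heat lo hi k x y) =
      ∑ j ∈ range (T + 1), τ j * ∑ i ∈ range (T + 1 - j), r (j + i) * b i := by
    calc _ = ∑ k ∈ range (T + 1), ∑ j ∈ range (k + 1), τ j * (r (j + (k - j)) * b (k - j)) := by
          refine sum_congr rfl fun k _ => ?_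
          rw [heat_sub_eq_sum hy'.1 hy k x hx.1.le hxy, mul_sum]
          refine sum_congr rfl fun j hj => ?_
          rw [Nat.add_sub_cancel' (by simpa [Nat.lt_succ_iff] using hj)]
          simp only [hτ, hb]; ring
      _ = ∑ j ∈ range (T + 1), ∑ i ∈ range (T + 1 - j), τ j * (r (j + i) * b i) :=
          sum_range_diag_flip (T + 1) fun j i => τ j * (r (j + i) * b i)
      _ = _ := by simp only [mul_sum]
  have hbR : ∀ R, -4 ≤ ∑ i ∈ range R, b i ∧ ∑ i ∈ range R, b i ≤ 0 := by
    intro R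
    cases R with
    | zero => simp
    | succ R =>
      have h1 := sum_heat_diag_sub_le R hy'
      have h2 := sum_heat_le_diag R (y + 2) hy'
      simp only [hb, sum_sub_distrib, heat_comm _ y (y + 2)]
      constructor <;> linarith
  rw [e]
  calc |∑ j ∈ range (T + 1), τ j * ∑ i ∈ range (T + 1 - j), r (j + i) * b i|
      ≤ ∑ j ∈ range (T + 1), τ j * (4 * r j) := by
        refine (abs_sum_le_sum_abs _ _).trans (sum_le_sum fun j _ => ?_)
        rw [abs_mul, abs_of_nonneg (hτ0 j)]
        refine mul_le_mul_of_nonneg_left ?_ (hτ0 j)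
        exact abs_sum_mul_le_of_antitone (r := fun i => r (j + i))
          (fun p q h => hr (Nat.add_le_add_left h j)) (fun k => hr0 _) (fun R => (hbR R).1)
          (fun R => (hbR R).2) _
    _ ≤ ∑ j ∈ range (T + 1), 4 * K * (τ j * ((j : ℝ) + 1) ^ (-a)) := by
        refine sum_le_sum fun j _ => ?_
        have := mul_le_mul_of_nonneg_left (hK j) (hτ0 j)
        linarith
    _ ≤ _ := by
        rw [← mul_sum]
        exact mul_le_mul_of_nonneg_left
          (sum_evolve_single_rpow_le ha0 ha1 T x hxy) (by positivity)

/-- The gradient of the Green function weighted by an antitone sequence. -/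
theorem abs_sum_mul_heat_sub_le {N : ℤ} {r : ℕ → ℝ} {K a : ℝ} (hr : Antitone r)
    (hr0 : ∀ k, 0 ≤ r k) (ha0 : 0 ≤ a) (ha1 : a ≤ 1)
    (hK : ∀ k : ℕ, r k ≤ K * ((k : ℝ) + 1) ^ (-a)) (T : ℕ) (x y : ℤ) :
    |∑ k ∈ range (T + 1), r k *
        (heat (-N) N k (2 * x) (2 * (y + 1)) - heat (-N) N k (2 * x) (2 * y))|
      ≤ 4 * K * (((|(x : ℝ) - y| + 1) ^ 2) / 5) ^ (-a) := by
  have hK0 : 0 ≤ K := by simpa using (hr0 0).trans (hK 0)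
  have hmono : ∀ D : ℝ, (|(x : ℝ) - y| + 1) ^ 2 / 5 ≤ 1 + D ^ 2 / 4 →
      4 * K * (1 + D ^ 2 / 4) ^ (-a) ≤ 4 * K * (((|(x : ℝ) - y| + 1) ^ 2) / 5) ^ (-a) :=
    fun D h => mul_le_mul_of_nonneg_left
      (Real.rpow_le_rpow_of_nonpos (by positivity) h (by linarith)) (by positivity)
  rcases le_or_gt x y with hxy | hxy
  · have h := abs_sum_mul_heat_sub_le_of_le (lo := -N) (hi := N) hr hr0 ha0 ha1 hK T
      (show 2 * x ≤ 2 * y by omega)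
    rw [show 2 * y + 2 = 2 * (y + 1) by ring] at h
    refine h.trans (hmono _ ?_)
    have : (x : ℝ) ≤ y := by exact_mod_cast hxy
    rw [abs_of_nonpos (by linarith)]
    push_cast
    nlinarith [sq_nonneg (2 * ((y : ℝ) - x) - 1 / 2)]
  -- Reflection in the origin exchanges the two sides, and the nearer point is now `y + 1`. The
  -- constant 5 is tight here: with `d = x - y`, `5 * (1 + (d - 1) ^ 2) - (d + 1) ^ 2 = (2 * d - 3)
  -- ^ 2`.
  · have h := abs_sum_mul_heat_sub_le_of_le (lo := -N) (hi := N) hr hr0 ha0 ha1 hK T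
      (show 2 * (-x) ≤ 2 * (-(y + 1)) by omega)
    rw [show 2 * (-(y + 1)) + 2 = -(2 * y) by ring, show 2 * (-(y + 1)) = -(2 * (y + 1)) by ring,
      show 2 * (-x) = -(2 * x) by ring] at h
    simp only [heat_neg] at h
    have e : ∑ k ∈ range (T + 1), r k *
          (heat (-N) N k (2 * x) (2 * (y + 1)) - heat (-N) N k (2 * x) (2 * y)) =
        -∑ k ∈ range (T + 1), r k *
          (heat (-N) N k (2 * x) (2 * y) - heat (-N) N k (2 * x) (2 * (y + 1))) := by
      rw [← sum_neg_distrib]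
      exact sum_congr rfl fun k _ => by ring
    rw [e, abs_neg]
    refine h.trans (hmono _ ?_)
    have : (y : ℝ) + 1 ≤ x := by exact_mod_cast hxy
    rw [abs_of_nonneg (by linarith)]
    push_cast
    nlinarith [sq_nonneg (2 * ((x : ℝ) - y) - 3)]

end SlitWalk

/-! ### The vertical walk: killing, drift and second moment. -/

namespace SlitWalk
open Finset Diamond

/-- The conductance between the levels `v` and `v + 1`. -/
noncomputable def edge (s : ℝ) (v : ℤ) : ℝ := levelConductance s (min v.natAbs (v + 1).natAbs)

theorem edge_pos {s : ℝ} (hs : 0 ≤ s) (v : ℤ) : 0 < edge s v := levelConductance_pos hs _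

theorem edge_natCast (s : ℝ) (r : ℕ) : edge s r = levelConductance s r := by
  unfold edge; congr 1; omega

theorem edge_neg (s : ℝ) (v : ℤ) : edge s (-v) = edge s (v - 1) := by
  unfold edge; congr 1; omega

open Classical in
/-- One step of the vertical component of the walk, killed outside `U`. -/
noncomputable def vertStep (s : ℝ) (U : Set ℤ) : (ℤ → ℝ) →ₗ[ℝ] (ℤ → ℝ) where
  toFun g v := if v ∈ U then
    edge s v / (edge s v + edge s (v - 1)) * g (v + 1)
      + edge s (v - 1) / (edge s v + edge s (v - 1)) * g (v - 1) else 0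
  map_add' f g := by
    ext v; simp only [Pi.add_apply]; split_ifs <;> ring
  map_smul' c f := by
    ext v; simp only [Pi.smul_apply, smul_eq_mul, RingHom.id_apply]; split_ifs <;> ring

variable {s : ℝ} {U : Set ℤ}

theorem vertStep_of_mem {v : ℤ} (hv : v ∈ U) (g : ℤ → ℝ) : vertStep s U g v =
    edge s v / (edge s v + edge s (v - 1)) * g (v + 1)
      + edge s (v - 1) / (edge s v + edge s (v - 1)) * g (v - 1) := by
  simp [vertStep, hv]

theorem vertStep_of_notMem {v : ℤ} (hv : v ∉ U) (g : ℤ → ℝ) : vertStep s U g v = 0 := by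
  simp [vertStep, hv]

theorem edge_div_add_edge_div (hs : 0 ≤ s) (v : ℤ) :
    edge s v / (edge s v + edge s (v - 1)) + edge s (v - 1) / (edge s v + edge s (v - 1)) = 1 := by
  have h1 := edge_pos hs v
  have h2 := edge_pos hs (v - 1)
  field_simp

theorem vertStep_le (hs : 0 ≤ s) {g : ℤ → ℝ} {v : ℤ} {c : ℝ} (hc : 0 ≤ c) (h1 : g (v + 1) ≤ c)
    (h2 : g (v - 1) ≤ c) : vertStep s U g v ≤ c := by
  by_cases hv : v ∈ U
  · rw [vertStep_of_mem hv]
    have e1 := edge_pos hs v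
    have e2 := edge_pos hs (v - 1)
    calc _ ≤ edge s v / (edge s v + edge s (v - 1)) * c
            + edge s (v - 1) / (edge s v + edge s (v - 1)) * c := by gcongr
      _ = c := by rw [← add_mul, edge_div_add_edge_div hs, one_mul]
  · rwa [vertStep_of_notMem hv]

theorem le_vertStep (hs : 0 ≤ s) {g : ℤ → ℝ} {v : ℤ} {c : ℝ} (hv : v ∈ U) (h1 : c ≤ g (v + 1))
    (h2 : c ≤ g (v - 1)) : c ≤ vertStep s U g v := by
  rw [vertStep_of_mem hv]
  have e1 := edge_pos hs v
  have e2 := edge_pos hs (v - 1)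
  calc c = edge s v / (edge s v + edge s (v - 1)) * c
            + edge s (v - 1) / (edge s v + edge s (v - 1)) * c := by
        rw [← add_mul, edge_div_add_edge_div hs, one_mul]
    _ ≤ _ := by gcongr

theorem vertStep_mono (hs : 0 ≤ s) {f g : ℤ → ℝ} (h : f ≤ g) :
    vertStep s U f ≤ vertStep s U g := by
  intro v
  by_cases hv : v ∈ U
  · rw [vertStep_of_mem hv, vertStep_of_mem hv]
    have e1 := edge_pos hs v
    have e2 := edge_pos hs (v - 1)
    have := h (v + 1)
    have := h (v - 1)
    gcongr
  · rw [vertStep_of_notMem hv, vertStep_of_notMem hv]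

theorem vertStep_pow_mono (hs : 0 ≤ s) {f g : ℤ → ℝ} (h : f ≤ g) (k : ℕ) :
    (vertStep s U ^ k) f ≤ (vertStep s U ^ k) g := by
  induction k with
  | zero => simpa using h
  | succ k ih =>
    rw [pow_succ', Module.End.mul_apply, Module.End.mul_apply]; exact vertStep_mono hs ih

theorem vertStep_pow_nonneg (hs : 0 ≤ s) {f : ℤ → ℝ} (h : 0 ≤ f) (k : ℕ) :
    0 ≤ (vertStep s U ^ k) f := by
  have := vertStep_pow_mono (U := U) hs h k
  rwa [map_zero] at this

/-- Killing only removes mass, so upper bounds need only be proved for the unkilled walk. -/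
theorem vertStep_pow_le_univ (hs : 0 ≤ s) {f : ℤ → ℝ} (h : 0 ≤ f) (k : ℕ) :
    (vertStep s U ^ k) f ≤ (vertStep s Set.univ ^ k) f := by
  induction k with
  | zero => simp
  | succ k ih =>
    rw [pow_succ', pow_succ', Module.End.mul_apply, Module.End.mul_apply]
    refine le_trans ?_ (vertStep_mono hs ih)
    intro v
    by_cases hv : v ∈ U
    · rw [vertStep_of_mem hv, vertStep_of_mem (Set.mem_univ v)]
    · rw [vertStep_of_notMem hv]
      have h0 := vertStep_pow_nonneg (U := U) hs h k
      exact le_vertStep hs (Set.mem_univ v) (h0 _) (h0 _)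

theorem vertStep_univ_one (hs : 0 ≤ s) : vertStep s Set.univ 1 = 1 := by
  ext v
  rw [vertStep_of_mem (Set.mem_univ v)]
  simp only [Pi.one_apply, mul_one]
  exact edge_div_add_edge_div hs v

theorem vertStep_univ_pow_one (hs : 0 ≤ s) (k : ℕ) : (vertStep s Set.univ ^ k) 1 = 1 := by
  induction k with
  | zero => simp
  | succ k ih => rw [pow_succ, Module.End.mul_apply, vertStep_univ_one hs, ih]

theorem levelConductance_succ_le (hs : 0 ≤ s) (r : ℕ) :
    levelConductance s (r + 1) ≤ levelConductance s r := by
  have h1 := levelConductance_pos hs r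
  have h2 : besselUp s (r + 1) ≤ 1 / 2 := by
    have : 0 ≤ s / 4 * (1 / ((r + 1 : ℕ) : ℝ)) := by positivity
    exact max_le (by linarith) (by norm_num)
  simp only [levelConductance]
  refine mul_le_of_le_one_left h1.le ?_
  rw [div_le_one (by linarith)]
  linarith

/-- The conductances do not increase away from level zero, so the drift points inwards; this is what
keeps the growth of the second moment at most one per step. -/
theorem edge_drift (hs : 0 ≤ s) (v : ℤ) : (v : ℝ) * (edge s v - edge s (v - 1)) ≤ 0 := by
  rcases lt_trichotomy v 0 with hv | rfl | hv
  · obtain ⟨r, rfl⟩ : ∃ r : ℕ, v = -((r : ℤ) + 1) := ⟨(-v - 1).toNat, by omega⟩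
    have h1 := edge_neg s ((r : ℤ) + 1)
    have h2 := edge_neg s ((r : ℤ) + 2)
    rw [show (r : ℤ) + 1 - 1 = r by ring, edge_natCast] at h1
    rw [show (r : ℤ) + 2 - 1 = (r + 1 : ℕ) by push_cast; ring, edge_natCast,
      show -((r : ℤ) + 2) = -((r : ℤ) + 1) - 1 by ring] at h2
    rw [h1, h2]
    have := levelConductance_succ_le hs r
    push_cast
    exact mul_nonpos_of_nonpos_of_nonneg (by linarith [(Nat.cast_nonneg r : (0:ℝ) ≤ r)])
      (by linarith)
  · simp
  · obtain ⟨r, rfl⟩ : ∃ r : ℕ, v = ((r + 1 : ℕ) : ℤ) := ⟨(v - 1).toNat, by omega⟩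
    rw [show ((r + 1 : ℕ) : ℤ) - 1 = (r : ℕ) by push_cast; ring, edge_natCast, edge_natCast]
    have := levelConductance_succ_le hs r
    exact mul_nonpos_of_nonneg_of_nonpos (by positivity) (by linarith)

/-- The second moment of the vertical component grows at most linearly. -/
theorem vertStep_pow_sq_le (hs : 0 ≤ s) (k : ℕ) (v : ℤ) :
    (vertStep s Set.univ ^ k) (fun w => (w : ℝ) ^ 2) v ≤ (v : ℝ) ^ 2 + k := by
  induction k generalizing v with
  | zero => simp
  | succ k ih =>
    have h : vertStep s Set.univ (fun w => (w : ℝ) ^ 2) ≤ (fun w : ℤ => (w : ℝ) ^ 2) + 1 := by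
      intro w
      rw [vertStep_of_mem (Set.mem_univ w)]
      have e1 := edge_pos hs w
      have e2 := edge_pos hs (w - 1)
      have e3 := edge_drift hs w
      simp only [Pi.add_apply, Pi.one_apply]
      push_cast
      rw [div_mul_eq_mul_div, div_mul_eq_mul_div, ← add_div, div_le_iff₀ (by positivity)]
      nlinarith
    rw [pow_succ, Module.End.mul_apply]
    refine (vertStep_pow_mono hs h k v).trans ?_
    rw [map_add, vertStep_univ_pow_one hs]
    have := ih v
    simp only [Pi.add_apply, Pi.one_apply]
    push_cast
    linarith

theorem besselUp_eq (hs1 : s ≤ 1) (r : ℕ) :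
    besselUp s (r + 1) = 1 / 2 - s / (4 * (r + 1)) := by
  unfold besselUp
  have hr : (0 : ℝ) ≤ r := Nat.cast_nonneg r
  push_cast
  rw [max_eq_left]
  · field_simp
  · have : s / 4 * (1 / ((r : ℝ) + 1)) ≤ 1 / 4 * 1 := by
      gcongr
      rw [div_le_one (by positivity)]; linarith
    linarith

theorem levelConductance_succ (_hs0 : 0 ≤ s) (hs1 : s ≤ 1) (r : ℕ) :
    levelConductance s (r + 1)
      = (2 * (r + 1) - s) / (2 * (r + 1) + s) * levelConductance s r := by
  have hr : (0 : ℝ) ≤ r := Nat.cast_nonneg r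
  simp only [levelConductance]
  rw [besselUp_eq hs1]
  congr 1
  have h : 1 - (1 / 2 - s / (4 * ((r : ℝ) + 1))) = (2 * (r + 1) + s) / (4 * (r + 1)) := by
    field_simp; ring
  have h' : (1 / 2 - s / (4 * ((r : ℝ) + 1))) = (2 * (r + 1) - s) / (4 * (r + 1)) := by
    field_simp; ring
  rw [h, h', div_div_div_cancel_right₀ (by positivity)]

/-- Bernoulli's inequality `(1 - u) ^ s ≤ 1 - s * u` with `u = 2 / (2 * r + 4 + s)` shows that the
product in `key` is nondecreasing in `r`. Its value at `r = 0` is `(2 - s) / (4 * (2 + s)) ≥ 1 /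
12`. -/
theorem inv_levelConductance_le (hs0 : 0 ≤ s) (hs1 : s ≤ 1) (r : ℕ) :
    1 / levelConductance s r ≤ 12 * ((r : ℝ) + 1) ^ s := by
  have key : ∀ r : ℕ, 1 / 12 ≤
      levelConductance s (r + 1) * ((2 * ((r : ℝ) + 1) + s) / (2 + s)) ^ s := by
    intro r
    induction r with
    | zero =>
      rw [levelConductance_succ hs0 hs1]
      simp only [Nat.cast_zero, zero_add, mul_one, levelConductance]
      rw [div_self (by positivity), Real.one_rpow, mul_one, div_mul_div_comm,
        div_le_div_iff₀ (by norm_num) (by positivity)]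
      linarith
    | succ r ih =>
      have hr : (0 : ℝ) ≤ r := Nat.cast_nonneg r
      rw [levelConductance_succ hs0 hs1]
      push_cast
      refine ih.trans ?_
      have hb := rpow_one_add_le_one_add_mul_self
        (s := -(2 / (2 * ((r : ℝ) + 1 + 1) + s))) (p := s)
        (by rw [neg_le_neg_iff, div_le_one (by positivity)]; linarith) hs0 hs1
      have e1 : 1 + -(2 / (2 * ((r : ℝ) + 1 + 1) + s))
          = ((2 * ((r : ℝ) + 1) + s) / (2 + s)) / ((2 * ((r : ℝ) + 1 + 1) + s) / (2 + s)) := by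
        field_simp; ring
      have e2 : 1 + s * -(2 / (2 * ((r : ℝ) + 1 + 1) + s))
          = (2 * ((r : ℝ) + 1 + 1) - s) / (2 * ((r : ℝ) + 1 + 1) + s) := by
        field_simp; ring
      rw [e1, e2, Real.div_rpow (by positivity) (by positivity),
        div_le_iff₀ (by positivity)] at hb
      have := mul_le_mul_of_nonneg_left hb (levelConductance_pos hs0 (r + 1)).le
      linarith
  rw [div_le_iff₀ (levelConductance_pos hs0 r)]
  cases r with
  | zero => simp [levelConductance]; norm_num
  | succ r =>
    have h1 := key r
    have h2 : ((2 * ((r : ℝ) + 1) + s) / (2 + s)) ^ s ≤ (((r + 1 : ℕ) : ℝ) + 1) ^ s := by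
      have hr : (0 : ℝ) ≤ r := Nat.cast_nonneg r
      refine Real.rpow_le_rpow (by positivity) ?_ hs0
      rw [div_le_iff₀ (by positivity)]
      push_cast
      nlinarith [mul_nonneg hr hs0]
    have := mul_le_mul_of_nonneg_left h2 (levelConductance_pos hs0 (r + 1)).le
    linarith

/-! ### Scale function and local time at level zero. -/

/-- The function of the level, harmonic off the origin, that measures the local time there. -/
noncomputable def scale (s : ℝ) (v : ℤ) : ℝ := ∑ j ∈ range v.natAbs, 1 / levelConductance s j

theorem scale_succ (hs : 0 ≤ s) (r : ℕ) :
    levelConductance s r * (scale s ((r : ℤ) + 1) - scale s r) = 1 := by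
  have := levelConductance_pos hs r
  unfold scale
  rw [show ((r : ℤ) + 1).natAbs = r + 1 by omega, Int.natAbs_natCast, sum_range_succ]
  field_simp
  ring

theorem scale_neg (v : ℤ) : scale s (-v) = scale s v := by unfold scale; rw [Int.natAbs_neg]

theorem edge_mul_scale_sub (hs : 0 ≤ s) (v : ℤ) :
    edge s v * (scale s (v + 1) - scale s v) = if 0 ≤ v then 1 else -1 := by
  split_ifs with hv
  · lift v to ℕ using hv
    rw [edge_natCast, scale_succ hs]
  · obtain ⟨r, rfl⟩ : ∃ r : ℕ, v = -((r : ℤ) + 1) := ⟨(-v - 1).toNat, by omega⟩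
    rw [edge_neg, show (r : ℤ) + 1 - 1 = r by ring, edge_natCast,
      show -((r : ℤ) + 1) + 1 = -r by ring, scale_neg, scale_neg, ← neg_inj, neg_neg,
      ← scale_succ hs r]
    ring

/-- The gradient flow of the scale function has unit strength outwards on every edge, hence no
divergence off the origin. At the origin two units leave through total conductance `1 / 2`, which
gives the 4. -/
theorem vertStep_scale (hs : 0 ≤ s) :
    vertStep s Set.univ (scale s) = scale s + (4 : ℝ) • Pi.single 0 1 := by
  ext v
  rw [vertStep_of_mem (Set.mem_univ v)]
  have e1 := edge_pos hs v
  have e2 := edge_pos hs (v - 1)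
  have h1 := edge_mul_scale_sub hs v
  have h2 := edge_mul_scale_sub hs (v - 1)
  rw [sub_add_cancel] at h2
  simp only [Pi.add_apply, Pi.smul_apply, smul_eq_mul, Pi.single_apply]
  rw [div_mul_eq_mul_div, div_mul_eq_mul_div, ← add_div, div_eq_iff (by positivity)]
  rcases lt_trichotomy v 0 with hv | rfl | hv
  · rw [if_neg (by omega)] at h1 h2
    rw [if_neg (by omega)]
    linarith
  · have e3 : edge s 0 = 1 / 4 := by simp [edge, levelConductance]
    have e4 : edge s (0 - 1) = 1 / 4 := by simp [edge, levelConductance]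
    rw [if_pos le_rfl] at h1
    rw [if_neg (by omega)] at h2
    rw [if_pos rfl]
    rw [e3] at h1 ⊢
    rw [e4] at h2 ⊢
    linarith
  · rw [if_pos (by omega)] at h1 h2
    rw [if_neg (by omega)]
    linarith

theorem vertStep_pow_scale (hs : 0 ≤ s) (T : ℕ) : (vertStep s Set.univ ^ T) (scale s) =
    scale s + (4 : ℝ) • ∑ t ∈ range T, (vertStep s Set.univ ^ t) (Pi.single 0 1) := by
  induction T with
  | zero => simp
  | succ T ih =>
    rw [pow_succ, Module.End.mul_apply, vertStep_scale hs, map_add, ih, map_smul, sum_range_succ]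
    module

/-- The return probabilities of the vertical component, killed outside `U`. -/
noncomputable def returnProb (s : ℝ) (U : Set ℤ) (k : ℕ) : ℝ :=
  (vertStep s U ^ k) (Pi.single 0 1) 0

theorem single_nonneg (w : ℤ) : (0 : ℤ → ℝ) ≤ Pi.single w 1 := by
  intro v; simp only [Pi.single_apply, Pi.zero_apply]; split_ifs <;> norm_num

theorem returnProb_nonneg (hs : 0 ≤ s) (k : ℕ) : 0 ≤ returnProb s U k :=
  vertStep_pow_nonneg hs (single_nonneg 0) k 0

theorem returnProb_le_univ (hs : 0 ≤ s) (k : ℕ) : returnProb s U k ≤ returnProb s Set.univ k :=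
  vertStep_pow_le_univ hs (single_nonneg 0) k 0

/-- The scale function grows at most like `|v| ^ (1 + s)`. Weighted AM-GM replaces this power by an
affine function of `v ^ 2`, whose expectation the second moment controls. -/
theorem scale_le (hs0 : 0 ≤ s) (hs1 : s ≤ 1) (v : ℤ) {T : ℝ} (hT : 0 < T) :
    scale s v ≤ 12 * T ^ ((1 + s) / 2) * (1 + (v : ℝ) ^ 2 / T) := by
  have hb0 : 0 ≤ (1 + s) / 2 := by linarith
  have h1 : scale s v ≤ 12 * ((v : ℝ) ^ 2) ^ ((1 + s) / 2) := by
    calc scale s v ≤ ∑ j ∈ range v.natAbs, 12 * (v.natAbs : ℝ) ^ s := by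
          refine sum_le_sum fun j hj => (inv_levelConductance_le hs0 hs1 j).trans ?_
          have : (j : ℝ) + 1 ≤ v.natAbs := by exact_mod_cast mem_range.1 hj
          gcongr
      _ = 12 * ((v : ℝ) ^ 2) ^ ((1 + s) / 2) := by
          rw [sum_const, card_range, nsmul_eq_mul]
          have e : (v : ℝ) ^ 2 = (v.natAbs : ℝ) ^ 2 := by
            rw [Nat.cast_natAbs]; push_cast; rw [sq_abs]
          rw [e, ← Real.rpow_natCast, ← Real.rpow_mul (Nat.cast_nonneg _),
            show ((2 : ℕ) : ℝ) * ((1 + s) / 2) = 1 + s by push_cast; ring,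
            Real.rpow_add_of_nonneg (Nat.cast_nonneg _) zero_le_one hs0, Real.rpow_one]
          ring
  have h2 := Real.geom_mean_le_arith_mean2_weighted hb0 (show 0 ≤ 1 - (1 + s) / 2 by linarith)
      (show 0 ≤ (v : ℝ) ^ 2 / T by positivity) zero_le_one (by ring)
  rw [Real.one_rpow, mul_one, mul_one, Real.div_rpow (by positivity) hT.le,
    div_le_iff₀ (by positivity)] at h2
  have h3 : (1 + s) / 2 * ((v : ℝ) ^ 2 / T) + (1 - (1 + s) / 2) ≤ 1 + (v : ℝ) ^ 2 / T := by
    have : 0 ≤ (v : ℝ) ^ 2 / T := by positivity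
    nlinarith
  have h4 := h2.trans (mul_le_mul_of_nonneg_right h3 (by positivity))
  linarith

/-- The scale function vanishes at the origin, so four times the local time equals its expectation
at time `T`, at most twice `12 * T ^ ((1 + s) / 2)`. -/
theorem sum_returnProb_le (hs0 : 0 ≤ s) (hs1 : s ≤ 1) {T : ℕ} (hT : 0 < T) :
    ∑ t ∈ range T, returnProb s Set.univ t ≤ 6 * (T : ℝ) ^ ((1 + s) / 2) := by
  have hT' : (0 : ℝ) < T := by exact_mod_cast hT
  have h1 : (vertStep s Set.univ ^ T) (scale s) 0 = 4 * ∑ t ∈ range T, returnProb s Set.univ t := by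
    rw [vertStep_pow_scale hs0]
    simp [scale, returnProb]
  set B : ℝ := 12 * (T : ℝ) ^ ((1 + s) / 2) with hB
  have h2 : scale s ≤ B • (1 : ℤ → ℝ) + (B / T) • fun v : ℤ => (v : ℝ) ^ 2 := by
    intro v
    refine (scale_le hs0 hs1 v hT').trans (le_of_eq ?_)
    simp only [Pi.add_apply, Pi.smul_apply, smul_eq_mul, Pi.one_apply]
    ring
  have h3 := vertStep_pow_mono (U := Set.univ) hs0 h2 T 0
  rw [map_add, map_smul, map_smul, vertStep_univ_pow_one hs0, h1] at h3
  simp only [Pi.add_apply, Pi.smul_apply, smul_eq_mul, Pi.one_apply] at h3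
  have h4 := vertStep_pow_sq_le hs0 T 0
  simp only [Int.cast_zero, ne_eq, OfNat.ofNat_ne_zero, not_false_eq_true, zero_pow, zero_add] at h4
  have h5 := mul_le_mul_of_nonneg_left h4 (show 0 ≤ B / T by positivity)
  rw [div_mul_cancel₀ _ hT'.ne'] at h5
  linarith

/-! ### Unimodality and decay of the return probabilities. -/

/-- Sets of levels that are symmetric and contain the inner neighbours of their elements. -/
def IsCentered (U : Set ℤ) : Prop := (∀ v, v ∈ U → -v ∈ U) ∧ ∀ v, 0 ≤ v → v + 2 ∈ U → v ∈ U

theorem isCentered_univ : IsCentered Set.univ := ⟨fun _ _ => trivial, fun _ _ _ => trivial⟩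

theorem isCentered_abs_lt (L : ℤ) : IsCentered {v | |v| < L} :=
  ⟨fun v hv => by simpa using hv, fun v hv h => by
    simp only [Set.mem_ofPred_eq, abs_lt] at h ⊢; omega⟩

/-- Levels are compared two apart because of parity. The new value at `v + 2` averages values at
most `g (v + 1)`, the one at `v` averages values at least `g (v + 1)`; whatever the step
probabilities, this suffices. At `v = 0` symmetry supplies `g (-1) = g 1`. -/
theorem vertStep_pow_single_unimodal (hs : 0 ≤ s) (hU : IsCentered U) (k : ℕ) :
    (∀ v, (vertStep s U ^ k) (Pi.single 0 1) (-v) = (vertStep s U ^ k) (Pi.single 0 1) v) ∧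
    ∀ v, 0 ≤ v →
      (vertStep s U ^ k) (Pi.single 0 1) (v + 2) ≤ (vertStep s U ^ k) (Pi.single 0 1) v := by
  induction k with
  | zero =>
    refine ⟨fun v => ?_, fun v hv => ?_⟩
    · simp [Pi.single_apply]
    · simp only [pow_zero, Module.End.one_apply, Pi.single_apply]
      rw [if_neg (by omega)]
      split_ifs <;> norm_num
  | succ k ih =>
    have h0 := vertStep_pow_nonneg (U := U) hs (single_nonneg 0) k
    rw [pow_succ', Module.End.mul_apply]
    set g := (vertStep s U ^ k) (Pi.single 0 1)
    refine ⟨fun v => ?_, fun v hv => ?_⟩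
    · by_cases hv : v ∈ U
      · rw [vertStep_of_mem hv, vertStep_of_mem (hU.1 v hv), edge_neg,
          show -v - 1 = -(v + 1) by ring, edge_neg, show -v + 1 = -(v - 1) by ring, ih.1, ih.1,
          add_sub_cancel_right]
        ring
      · rw [vertStep_of_notMem hv, vertStep_of_notMem fun h => hv (by simpa using hU.1 _ h)]
    · by_cases h2 : v + 2 ∈ U
      · refine (vertStep_le hs (c := g (v + 1)) (h0 _) ?_ ?_).trans
          (le_vertStep hs (hU.2 v hv h2) le_rfl ?_)
        · have := ih.2 (v + 1) (by omega)
          rwa [show v + 1 + 2 = v + 2 + 1 by ring] at this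
        · rw [show v + 2 - 1 = v + 1 by ring]
        · rcases hv.eq_or_lt with rfl | hv
          · rw [← ih.1]; simp
          · have := ih.2 (v - 1) (by omega)
            rwa [show v - 1 + 2 = v + 1 by ring] at this
      · rw [vertStep_of_notMem h2]
        have := vertStep_mono (U := U) hs h0 v
        rwa [map_zero] at this

theorem returnProb_add_two_le (hs : 0 ≤ s) (hU : IsCentered U) (k : ℕ) :
    returnProb s U (k + 2) ≤ returnProb s U k := by
  obtain ⟨h1, h2⟩ := vertStep_pow_single_unimodal hs hU k
  have h0 := vertStep_pow_nonneg (U := U) hs (single_nonneg 0) k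
  unfold returnProb
  rw [pow_succ', Module.End.mul_apply, pow_succ', Module.End.mul_apply]
  set g := (vertStep s U ^ k) (Pi.single 0 1)
  have h3 : g 2 ≤ g 0 := h2 0 le_rfl
  refine vertStep_le hs (h0 0) (vertStep_le hs (h0 0) ?_ ?_) (vertStep_le hs (h0 0) ?_ ?_)
  · simpa using h3
  · simp
  · simp
  · have := h1 2
    norm_num at this ⊢
    rwa [this]

/-- The antitone majorant of the return probabilities, equal to them at even times. -/
noncomputable def returnBound (s : ℝ) (U : Set ℤ) (k : ℕ) : ℝ := returnProb s U (2 * (k / 2))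

theorem returnBound_antitone (hs : 0 ≤ s) (hU : IsCentered U) : Antitone (returnBound s U) := by
  have h : Antitone fun j => returnProb s U (2 * j) :=
    antitone_nat_of_succ_le fun j => returnProb_add_two_le hs hU (2 * j)
  exact fun i j hij => h (Nat.div_le_div_right hij)

theorem returnBound_nonneg (hs : 0 ≤ s) (k : ℕ) : 0 ≤ returnBound s U k := returnProb_nonneg hs _

theorem returnBound_of_even {k : ℕ} (hk : Even k) : returnBound s U k = returnProb s U k := by
  unfold returnBound; rw [Nat.two_mul_div_two_of_even hk]

/-- By monotonicity along even times, the last of `m = k / 2 + 1` even-time terms is at most their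
mean, and the local time up to `2 * m` bounds their sum. -/
theorem returnBound_le (hs0 : 0 ≤ s) (hs1 : s ≤ 1) (k : ℕ) :
    returnBound s U k ≤ 12 * ((k : ℝ) + 1) ^ (-((1 - s) / 2)) := by
  refine (returnProb_le_univ hs0 _).trans ?_
  set m : ℕ := k / 2 + 1 with hm
  have hanti : Antitone fun j => returnProb s Set.univ (2 * j) :=
    antitone_nat_of_succ_le fun j => returnProb_add_two_le hs0 isCentered_univ (2 * j)
  have h1 := sum_returnProb_le hs0 hs1 (show 0 < 2 * m by omega)
  have h2 : ∀ m : ℕ, ∑ j ∈ range m, returnProb s Set.univ (2 * j) ≤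
      ∑ t ∈ range (2 * m), returnProb s Set.univ t := by
    intro m
    induction m with
    | zero => simp
    | succ m ih =>
      rw [sum_range_succ, show 2 * (m + 1) = 2 * m + 1 + 1 by ring, sum_range_succ, sum_range_succ]
      linarith [returnProb_nonneg (U := Set.univ) hs0 (2 * m + 1)]
  have h3 : (m : ℝ) * returnProb s Set.univ (2 * (k / 2)) ≤
      ∑ j ∈ range m, returnProb s Set.univ (2 * j) := by
    have : ∑ j ∈ range m, returnProb s Set.univ (2 * (k / 2)) ≤
        ∑ j ∈ range m, returnProb s Set.univ (2 * j) :=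
      sum_le_sum fun j hj => hanti (show j ≤ k / 2 by have := mem_range.1 hj; omega)
    simpa using this
  have h4 := h3.trans ((h2 m).trans h1)
  have hm0 : (0 : ℝ) < m := by rw [hm]; positivity
  have hkm : (k : ℝ) + 1 ≤ ((2 * m : ℕ) : ℝ) := by
    have : k + 1 ≤ 2 * m := by omega
    exact_mod_cast this
  calc returnProb s Set.univ (2 * (k / 2))
      ≤ 6 * ((2 * m : ℕ) : ℝ) ^ ((1 + s) / 2) / m := by
        rw [le_div_iff₀ hm0]; linarith
    _ = 12 * ((2 * m : ℕ) : ℝ) ^ (-((1 - s) / 2)) := by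
        rw [show (1 + s) / 2 = -((1 - s) / 2) + 1 by ring,
          Real.rpow_add_one (by push_cast; positivity)]
        push_cast
        field_simp
        ring
    _ ≤ 12 * ((k : ℝ) + 1) ^ (-((1 - s) / 2)) := by
        gcongr ?_ * ?_
        exact Real.rpow_le_rpow_of_nonpos (by positivity) hkm (by linarith)

theorem vertStep_pow_single_eq_zero (k : ℕ) {v : ℤ} (h : Odd (k + v)) :
    (vertStep s U ^ k) (Pi.single 0 1) v = 0 := by
  induction k generalizing v with
  | zero =>
    simp only [Nat.cast_zero, zero_add] at h
    simp only [pow_zero, Module.End.one_apply, Pi.single_apply]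
    rw [if_neg]
    rintro rfl
    simp at h
  | succ k ih =>
    rw [pow_succ', Module.End.mul_apply]
    by_cases hv : v ∈ U
    · have h1 : Odd ((k : ℤ) + (v - 1)) := by
        push_cast at h; rw [show (k : ℤ) + (v - 1) = (k + 1 + v) - 2 by ring]
        exact h.sub_even even_two
      have h2 : Odd ((k : ℤ) + (v + 1)) := by
        push_cast at h; rw [show (k : ℤ) + (v + 1) = k + 1 + v by ring]; exact h
      rw [vertStep_of_mem hv, ih h1, ih h2]; ring
    · rw [vertStep_of_notMem hv]

/-- At even times unimodality puts the maximum at the origin; an odd time is one averaging step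
later. -/
theorem vertStep_pow_single_le (hs : 0 ≤ s) (hU : IsCentered U) (k : ℕ) (v : ℤ) :
    (vertStep s U ^ k) (Pi.single 0 1) v ≤ returnBound s U k := by
  have heven : ∀ j : ℕ, ∀ v, (vertStep s U ^ (2 * j)) (Pi.single 0 1) v ≤
      returnProb s U (2 * j) := by
    intro j v
    rcases Int.even_or_odd v with hv | hv
    · obtain ⟨h1, h2⟩ := vertStep_pow_single_unimodal hs hU (2 * j)
      have h3 : ∀ i : ℕ, (vertStep s U ^ (2 * j)) (Pi.single 0 1) (2 * (i : ℤ)) ≤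
          returnProb s U (2 * j) := by
        intro i
        induction i with
        | zero => simp [returnProb]
        | succ i ih =>
          refine le_trans ?_ ih
          have := h2 (2 * (i : ℤ)) (by omega)
          rwa [show 2 * (i : ℤ) + 2 = 2 * ((i + 1 : ℕ) : ℤ) by push_cast; ring] at this
      obtain ⟨w, hw⟩ := hv
      rcases le_total 0 w with h | h
      · have := h3 w.toNat
        rwa [show 2 * (w.toNat : ℤ) = v by omega] at this
      · have := h3 (-w).toNat
        rwa [show 2 * ((-w).toNat : ℤ) = -v by omega, h1] at this
    · rw [vertStep_pow_single_eq_zero]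
      · exact returnProb_nonneg hs _
      · exact Even.add_odd (by simp) hv
  rcases Nat.even_or_odd' k with ⟨j, rfl | rfl⟩
  · unfold returnBound
    rw [show 2 * (2 * j / 2) = 2 * j by omega]
    exact heven j v
  · unfold returnBound
    rw [show 2 * ((2 * j + 1) / 2) = 2 * j by omega, pow_succ', Module.End.mul_apply]
    exact vertStep_le hs (returnProb_nonneg hs _) (heven j _) (heven j _)

end SlitWalk

/-! ### Survival estimates and mirror coupling for simple random walk. -/

namespace SlitWalk
open Finset Diamond

theorem sum_rpow_le {b : ℝ} (hb0 : 0 < b) (hb1 : b ≤ 1) (m : ℕ) :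
    ∑ j ∈ range m, ((j : ℝ) + 1) ^ (b - 1) ≤ (m : ℝ) ^ b / b := by
  induction m with
  | zero => simp [Real.zero_rpow hb0.ne']
  | succ m ih =>
    rw [sum_range_succ]
    have hm : (0 : ℝ) < (m : ℝ) + 1 := by positivity
    have h := rpow_one_add_le_one_add_mul_self (s := -(1 / ((m : ℝ) + 1))) (p := b)
      (by rw [neg_le_neg_iff, div_le_one hm]; linarith [(Nat.cast_nonneg m : (0 : ℝ) ≤ m)])
      hb0.le hb1
    rw [show 1 + -(1 / ((m : ℝ) + 1)) = m / ((m : ℝ) + 1) by field_simp; ring,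
      Real.div_rpow (Nat.cast_nonneg m) hm.le, div_le_iff₀ (by positivity)] at h
    have e : ((m : ℝ) + 1) ^ b = ((m : ℝ) + 1) ^ (b - 1) * ((m : ℝ) + 1) := by
      rw [← Real.rpow_add_one hm.ne']; ring_nf
    have e2 : (1 + b * -(1 / ((m : ℝ) + 1))) * ((m : ℝ) + 1) ^ b
        = ((m : ℝ) + 1) ^ b - b * ((m : ℝ) + 1) ^ (b - 1) := by
      rw [e]; field_simp; ring
    rw [e2] at h
    push_cast
    have h' : (m : ℝ) ^ b / b ≤ (((m : ℝ) + 1) ^ b - b * ((m : ℝ) + 1) ^ (b - 1)) / b := by gcongr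
    rw [sub_div, mul_div_cancel_left₀ _ hb0.ne'] at h'
    linarith

theorem levelConductance_zero (r : ℕ) : levelConductance 0 r = 1 / 4 := by
  induction r with
  | zero => rfl
  | succ r ih => rw [levelConductance_succ le_rfl zero_le_one, ih, add_zero, sub_zero,
      div_self (by positivity), one_mul]

theorem vertStep_zero_apply (g : ℤ → ℝ) (v : ℤ) :
    vertStep 0 Set.univ g v = (g (v - 1) + g (v + 1)) / 2 := by
  rw [vertStep_of_mem (Set.mem_univ v)]
  simp only [edge, levelConductance_zero]
  ring

/-- The expected sign of simple random walk at time `T`, as a function of the starting point. For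
`i ≥ 0` this is the probability that the walk started at `i` has not met the origin. -/
noncomputable def meanSign (T : ℕ) : ℤ → ℝ :=
  (vertStep 0 Set.univ ^ T) fun i => ((SignType.sign i : SignType) : ℝ)

theorem meanSign_zero (i : ℤ) : meanSign 0 i = if 0 < i then 1 else if i < 0 then -1 else 0 := by
  simp only [meanSign, pow_zero, Module.End.one_apply]
  split_ifs with h1 h2
  · simp [sign_pos h1]
  · simp [sign_neg h2]
  · simp [show i = 0 by omega]

theorem meanSign_succ (T : ℕ) (i : ℤ) :
    meanSign (T + 1) i = (meanSign T (i - 1) + meanSign T (i + 1)) / 2 := by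
  unfold meanSign
  rw [pow_succ', Module.End.mul_apply, vertStep_zero_apply]

theorem meanSign_neg (T : ℕ) (i : ℤ) : meanSign T (-i) = -meanSign T i := by
  induction T generalizing i with
  | zero => simp only [meanSign_zero]; split_ifs <;> first | omega | norm_num
  | succ T ih =>
    rw [meanSign_succ, meanSign_succ, show -i - 1 = -(i + 1) by ring,
      show -i + 1 = -(i - 1) by ring, ih, ih]
    ring

theorem meanSign_apply_zero (T : ℕ) : meanSign T 0 = 0 := by
  have := meanSign_neg T 0
  simp only [neg_zero] at this
  linarith

theorem meanSign_nonneg (T : ℕ) {i : ℤ} (hi : 0 ≤ i) : 0 ≤ meanSign T i := by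
  rcases hi.eq_or_lt with rfl | hi'
  · rw [meanSign_apply_zero]
  clear hi
  rename' hi' => hi
  induction T generalizing i with
  | zero => rw [meanSign_zero, if_pos hi]; norm_num
  | succ T ih =>
    rw [meanSign_succ]
    have h1 := ih (i := i + 1) (by omega)
    have h2 : 0 ≤ meanSign T (i - 1) := by
      rcases (show 0 ≤ i - 1 by omega).eq_or_lt with h | h
      · rw [← h, meanSign_apply_zero]
      · exact ih h
    linarith

/-- Concavity on the half-line, for the odd extension. It propagates in `T` because at `j = 0`
oddness makes both sides zero, while for `j > 0` the neighbours stay in the half-line. -/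
theorem meanSign_add_add_meanSign_sub_le (T : ℕ) {i j : ℤ} (hi : 0 ≤ i) (hj : 0 ≤ j) :
    meanSign T (j + i) + meanSign T (j - i) ≤ 2 * meanSign T j := by
  induction T generalizing j with
  | zero => simp only [meanSign_zero]; split_ifs <;> first | omega | norm_num
  | succ T ih =>
    rcases hj.eq_or_lt with rfl | hj
    · rw [zero_add, zero_sub, meanSign_neg, meanSign_apply_zero]; simp
    · have h1 := ih (j := j + 1) (by omega)
      have h2 := ih (j := j - 1) (by omega)
      rw [meanSign_succ, meanSign_succ, meanSign_succ,
        show j + i - 1 = j - 1 + i by ring, show j + i + 1 = j + 1 + i by ring,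
        show j - i - 1 = j - 1 - i by ring, show j - i + 1 = j + 1 - i by ring]
      linarith

theorem meanSign_two_mul_le (T : ℕ) {i : ℤ} (hi : 0 ≤ i) :
    meanSign T (2 * i) ≤ 2 * meanSign T i := by
  have := meanSign_add_add_meanSign_sub_le T hi hi
  rwa [sub_self, meanSign_apply_zero, add_zero, ← two_mul] at this

/-- The centred difference of the sign function is `2 δ₀` plus `2` times one step of `δ₀`. Both
sides solve the same recursion, so survival probabilities become return probabilities. -/
theorem meanSign_add_one_sub (T : ℕ) (i : ℤ) : meanSign T (i + 1) - meanSign T (i - 1) =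
    2 * (vertStep 0 Set.univ ^ T) (Pi.single 0 1) i
      + 2 * (vertStep 0 Set.univ ^ (T + 1)) (Pi.single 0 1) i := by
  induction T generalizing i with
  | zero =>
    simp only [meanSign_zero, pow_zero, zero_add, pow_one, Module.End.one_apply,
      vertStep_zero_apply, Pi.single_apply]
    split_ifs <;> first | omega | norm_num
  | succ T ih =>
    rw [meanSign_succ, meanSign_succ, pow_succ', Module.End.mul_apply, vertStep_zero_apply,
      pow_succ' _ (T + 1), Module.End.mul_apply, vertStep_zero_apply]
    have h1 := ih (i - 1)
    have h2 := ih (i + 1)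
    rw [sub_add_cancel] at h1 ⊢
    rw [add_sub_cancel_right] at h2 ⊢
    linarith

theorem meanSign_one_le (T : ℕ) : meanSign T 1 ≤ 24 * ((T : ℝ) + 1) ^ (-(1 / 2 : ℝ)) := by
  have h := meanSign_add_one_sub T 0
  rw [zero_add, zero_sub, meanSign_neg] at h
  have h1 := vertStep_pow_single_le (s := 0) le_rfl isCentered_univ T 0
  have h2 := vertStep_pow_single_le (s := 0) le_rfl isCentered_univ (T + 1) 0
  have h3 := returnBound_antitone (s := 0) le_rfl isCentered_univ (Nat.le_succ T)
  have h4 := returnBound_le (s := 0) (U := Set.univ) le_rfl zero_le_one T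
  rw [sub_zero] at h4
  linarith

section coupling
variable {N : ℤ} {g : ℤ → ℝ}

theorem evolve_eq_zero (h0 : ∀ z, ¬(-N < z ∧ z < N) → g z = 0) (T : ℕ) {z : ℤ}
    (hz : ¬(-N < z ∧ z < N)) : evolve (-N) N g T z = 0 := by
  cases T with
  | zero => exact h0 z hz
  | succ T => exact evolve_succ_of_not_mem _ _ hz

/-- Survival in the interval implies avoiding each endpoint separately. -/
theorem abs_evolve_le_meanSign (h0 : ∀ z, ¬(-N < z ∧ z < N) → g z = 0) (h1 : ∀ z, |g z| ≤ 1)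
    (T : ℕ) {z : ℤ} (hz : -N ≤ z) (hz' : z ≤ N) :
    |evolve (-N) N g T z| ≤ meanSign T (N - z) ∧ |evolve (-N) N g T z| ≤ meanSign T (N + z) := by
  by_cases hm : -N < z ∧ z < N
  swap
  · rw [evolve_eq_zero h0 T hm, abs_zero]
    exact ⟨meanSign_nonneg T (by omega), meanSign_nonneg T (by omega)⟩
  induction T generalizing z with
  | zero =>
    rw [meanSign_zero, meanSign_zero, if_pos (by omega), if_pos (by omega)]
    exact ⟨h1 z, h1 z⟩
  | succ T ih =>
    have ih' : ∀ z, -N ≤ z → z ≤ N → |evolve (-N) N g T z| ≤ meanSign T (N - z) ∧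
        |evolve (-N) N g T z| ≤ meanSign T (N + z) := by
      intro z hz hz'
      by_cases hm : -N < z ∧ z < N
      · exact ih hz hz' hm
      · rw [evolve_eq_zero h0 T hm, abs_zero]
        exact ⟨meanSign_nonneg T (by omega), meanSign_nonneg T (by omega)⟩
    have a1 := ih' (z - 1) (by omega) (by omega)
    have a2 := ih' (z + 1) (by omega) (by omega)
    have e : |evolve (-N) N g (T + 1) z| ≤
        (|evolve (-N) N g T (z - 1)| + |evolve (-N) N g T (z + 1)|) / 2 := by
      rw [evolve_succ_of_mem _ _ hm, abs_div, abs_two]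
      gcongr
      exact abs_add_le _ _
    rw [meanSign_succ, meanSign_succ, show N - z - 1 = N - (z + 1) by ring,
      show N - z + 1 = N - (z - 1) by ring, show N + z - 1 = N + (z - 1) by ring,
      show N + z + 1 = N + (z + 1) by ring]
    constructor <;> linarith [a1.1, a1.2, a2.1, a2.2]

/-- The mirror coupling of two walks killed outside an interval. -/
theorem abs_evolve_sub_le (h0 : ∀ z, ¬(-N < z ∧ z < N) → g z = 0) (h1 : ∀ z, |g z| ≤ 1)
    (T : ℕ) {z i : ℤ} (hi : 0 ≤ i) (hz : -N ≤ z) (hz' : z + 2 * i ≤ N) :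
    |evolve (-N) N g T z - evolve (-N) N g T (z + 2 * i)| ≤ 2 * meanSign T i := by
  induction T generalizing z i with
  | zero =>
    rcases hi.eq_or_lt with rfl | hi
    · simp [meanSign_zero]
    · rw [meanSign_zero, if_pos hi]
      have a1 := abs_le.1 (h1 z)
      have a2 := abs_le.1 (h1 (z + 2 * i))
      simp only [evolve]
      rw [abs_le]; constructor <;> linarith [a1.1, a1.2, a2.1, a2.2]
  | succ T ih =>
    rcases hi.eq_or_lt with rfl | hi
    · simp [meanSign_apply_zero]
    -- When one walk is killed, the other is at distance `2 * i` from that endpoint; doubling brings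
    -- its survival probability back to the claimed bound.
    have hdouble := meanSign_two_mul_le (T + 1) hi.le
    rcases hz.eq_or_lt with rfl | hz
    · rw [evolve_succ_of_not_mem _ _ (x := -N) (by omega), zero_sub, abs_neg]
      have := (abs_evolve_le_meanSign h0 h1 (T + 1) (z := -N + 2 * i) (by omega) hz').2
      rw [show N + (-N + 2 * i) = 2 * i by ring] at this
      linarith
    rcases hz'.eq_or_lt with hz' | hz'
    · rw [evolve_succ_of_not_mem _ _ (x := z + 2 * i) (by omega), sub_zero]
      have := (abs_evolve_le_meanSign h0 h1 (T + 1) (z := z) hz.le (by omega)).1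
      rw [show N - z = 2 * i by omega] at this
      linarith
    rw [evolve_succ_of_mem _ _ (by omega), evolve_succ_of_mem _ _ (by omega), meanSign_succ]
    -- The two walks take opposite steps, so half their distance is itself a simple random walk.
    have a1 := ih (z := z - 1) (i := i + 1) (by omega) (by omega) (by omega)
    have a2 := ih (z := z + 1) (i := i - 1) (by omega) (by omega) (by omega)
    rw [show z - 1 + 2 * (i + 1) = z + 2 * i + 1 by ring] at a1
    rw [show z + 1 + 2 * (i - 1) = z + 2 * i - 1 by ring] at a2
    rw [abs_le] at a1 a2 ⊢
    constructor <;> linarith [a1.1, a1.2, a2.1, a2.2]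

theorem abs_evolve_add_two_sub_le (h0 : ∀ z, ¬(-N < z ∧ z < N) → g z = 0)
    (h1 : ∀ z, |g z| ≤ 1) (T : ℕ) (z : ℤ) :
    |evolve (-N) N g T (z + 2) - evolve (-N) N g T z| ≤ 2 * meanSign T 1 := by
  have hn := meanSign_nonneg T (i := 1) zero_le_one
  by_cases hz : -N ≤ z ∧ z + 2 ≤ N
  · have := abs_evolve_sub_le h0 h1 T zero_le_one hz.1 (by omega : z + 2 * 1 ≤ N)
    rwa [abs_sub_comm] at this
  by_cases hz1 : -N < z ∧ z < N
  · rw [evolve_eq_zero h0 T (z := z + 2) (by omega), zero_sub, abs_neg]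
    have := (abs_evolve_le_meanSign h0 h1 T hz1.1.le hz1.2.le).1
    rw [show N - z = 1 by omega] at this
    linarith
  by_cases hz2 : -N < z + 2 ∧ z + 2 < N
  · rw [evolve_eq_zero h0 T hz1, sub_zero]
    have := (abs_evolve_le_meanSign h0 h1 T hz2.1.le hz2.2.le).2
    rw [show N + (z + 2) = 1 by omega] at this
    linarith
  · rw [evolve_eq_zero h0 T hz1, evolve_eq_zero h0 T hz2, sub_zero, abs_zero]
    linarith

/-- The total variation in space of the exit time distribution, after a given time. -/
theorem sum_abs_evolve_single_sub_le {w : ℤ} (hw : ¬(-N < w ∧ w < N)) (T R : ℕ) (z : ℤ) :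
    ∑ k ∈ range R, |evolve (-N) N (Pi.single w 1) (k + 1 + T) (z + 2)
      - evolve (-N) N (Pi.single w 1) (k + 1 + T) z| ≤ 2 * meanSign T 1 := by
  set e : ℕ → ℤ → ℝ := evolve (-N) N (Pi.single w 1) with he
  -- Duality: with these signs the total variation is the gradient at time `T` of one function
  -- bounded by one. The shift to `k + 1` makes that function vanish off the interval, which fails
  -- for the indicator at time zero.
  set σ : ℕ → ℝ := fun k => if 0 ≤ e (k + 1 + T) (z + 2) - e (k + 1 + T) z then 1 else -1 with hσ
  have hσ1 : ∀ k, |σ k| = 1 := fun k => by simp only [hσ]; split_ifs <;> norm_num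
  have hen : ∀ k x, 0 ≤ e k x := fun k x => evolve_nonneg (single_nonneg w) k x
  have h0 : ∀ x, ¬(-N < x ∧ x < N) → ∑ k ∈ range R, σ k * e (k + 1) x = 0 := fun x hx =>
    sum_eq_zero fun k _ => by rw [he, evolve_succ_of_not_mem _ _ hx, mul_zero]
  have h1 : ∀ x, |∑ k ∈ range R, σ k * e (k + 1) x| ≤ 1 := by
    intro x
    calc |∑ k ∈ range R, σ k * e (k + 1) x| ≤ ∑ k ∈ range R, e (k + 1) x := by
          refine (abs_sum_le_sum_abs _ _).trans (sum_le_sum fun k _ => ?_)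
          rw [abs_mul, hσ1, one_mul, abs_of_nonneg (hen _ _)]
      _ ≤ ∑ k ∈ range (R + 1), e k x := by
          rw [sum_range_succ']; linarith [hen 0 x]
      _ ≤ 1 := sum_evolve_single_le_one hw R x
  have h := abs_evolve_add_two_sub_le h0 h1 T z
  rw [evolve_sum, evolve_sum, ← sum_sub_distrib] at h
  refine le_trans (le_of_eq ?_) ((le_abs_self _).trans h)
  refine sum_congr rfl fun k _ => ?_
  rw [he, evolve_evolve, evolve_evolve, ← he, ← mul_sub]
  simp only [hσ]
  split_ifs with hk
  · rw [abs_of_nonneg hk, one_mul]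
  · rw [abs_of_neg (not_le.1 hk)]; ring

/-- The gradient of the solution with slowly growing boundary values. -/
theorem sum_abs_evolve_single_sub_mul_le {w : ℤ} (hw : ¬(-N < w ∧ w < N)) {c : ℕ → ℝ} {F : ℝ}
    (hF : 0 ≤ F) {m : ℕ} (hm : 0 < m) (hc : ∀ k, c k ≤ F) (hck : ∀ k : ℕ, c k ≤ F * (k / m))
    (R : ℕ) (z : ℤ) :
    ∑ k ∈ range R, |evolve (-N) N (Pi.single w 1) k (z + 2)
      - evolve (-N) N (Pi.single w 1) k z| * c k ≤ 96 * F * (m : ℝ) ^ (-(1 / 2 : ℝ)) := by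
  set η : ℕ → ℝ := fun k => |evolve (-N) N (Pi.single w 1) k (z + 2)
      - evolve (-N) N (Pi.single w 1) k z| with hη
  have hη0 : ∀ k, 0 ≤ η k := fun k => abs_nonneg _
  have hm0 : (0 : ℝ) < m := by exact_mod_cast hm
  -- Layer cake: `min m k` counts the `T < m` with `T < k`, so the weighted sum becomes an average
  -- of the tails of the total variation.
  have hcm : ∀ k, c k ≤ F / m * ∑ T ∈ range m, if T < k then (1 : ℝ) else 0 := by
    intro k
    have e : ∑ T ∈ range m, (if T < k then (1 : ℝ) else 0) = min m k := by
      rw [sum_ite, sum_const_zero, add_zero, sum_const, nsmul_eq_mul, mul_one]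
      have : (range m).filter (fun T => T < k) = range (min m k) := by ext T; simp
      rw [this, card_range, Nat.cast_min]
    rw [e, Nat.cast_min]
    rcases le_total (m : ℝ) k with h | h
    · rw [min_eq_left h, div_mul_cancel₀ _ hm0.ne']; exact hc k
    · rw [min_eq_right h]
      refine (hck k).trans (le_of_eq ?_)
      ring
  have htail : ∀ T, ∑ k ∈ range R, η k * (if T < k then (1 : ℝ) else 0) ≤
      48 * ((T : ℝ) + 1) ^ (1 / 2 - 1 : ℝ) := by
    intro T
    have h1 : ∑ k ∈ range R, η k * (if T < k then (1 : ℝ) else 0) ≤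
        ∑ k ∈ range (R + (T + 1)), η k * (if T < k then (1 : ℝ) else 0) :=
      sum_le_sum_of_subset_of_nonneg (range_subset_range.2 (by omega)) fun k _ _ =>
        mul_nonneg (hη0 k) (by split_ifs <;> norm_num)
    have h2 : ∑ k ∈ range (R + (T + 1)), η k * (if T < k then (1 : ℝ) else 0) =
        ∑ k ∈ range R, η (k + 1 + T) := by
      rw [add_comm R, sum_range_add, sum_eq_zero, zero_add]
      · refine sum_congr rfl fun k _ => ?_
        rw [if_pos (by omega), mul_one]; congr 1; omega
      · intro k hk
        rw [if_neg (by have := mem_range.1 hk; omega), mul_zero]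
    have h3 := sum_abs_evolve_single_sub_le hw T R z
    have h4 := meanSign_one_le T
    rw [show (1 / 2 - 1 : ℝ) = -(1 / 2) by norm_num]
    rw [h2] at h1
    linarith
  calc ∑ k ∈ range R, η k * c k
      ≤ ∑ k ∈ range R, η k * (F / m * ∑ T ∈ range m, if T < k then (1 : ℝ) else 0) :=
        sum_le_sum fun k _ => mul_le_mul_of_nonneg_left (hcm k) (hη0 k)
    _ = F / m * ∑ T ∈ range m, ∑ k ∈ range R, η k * (if T < k then (1 : ℝ) else 0) := by
        rw [sum_comm, mul_sum]
        refine sum_congr rfl fun k _ => ?_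
        rw [← mul_sum]; ring
    _ ≤ F / m * ∑ T ∈ range m, 48 * ((T : ℝ) + 1) ^ (1 / 2 - 1 : ℝ) := by
        gcongr with T _
        exact htail T
    _ ≤ F / m * (48 * ((m : ℝ) ^ (1 / 2 : ℝ) / (1 / 2))) := by
        rw [← mul_sum]
        gcongr
        exact sum_rpow_le (by norm_num) (by norm_num) m
    _ = 96 * F * (m : ℝ) ^ (-(1 / 2 : ℝ)) := by
        rw [show (1 / 2 : ℝ) = -(1 / 2) + 1 by norm_num, Real.rpow_add_one hm0.ne']
        field_simp
        norm_num
        left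
        ring

end coupling

end SlitWalk

/-! ### The walk on the diamond graph in product coordinates. -/

namespace SlitWalk
open Finset Diamond

variable {s : ℝ} {U : Set DiamondVertex}

theorem sum_neighbors (f : DiamondVertex → ℝ) (z : DiamondVertex) : ∑ w ∈ neighbors z, f w =
    f (z.1 + 1, z.2) + f (z.1 - 1, z.2) + f (z.1, z.2 + 1) + f (z.1, z.2 - 1) := by
  unfold neighbors
  rw [sum_insert, sum_insert, sum_insert, sum_singleton]
  · ring
  all_goals simp only [mem_insert, mem_singleton, Prod.mk.injEq]; omega

theorem mem_neighbors_comm (z w : DiamondVertex) : w ∈ neighbors z ↔ z ∈ neighbors w := by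
  obtain ⟨a, b⟩ := z
  obtain ⟨c, d⟩ := w
  simp only [neighbors, mem_insert, mem_singleton, Prod.mk.injEq]
  omega

theorem conductance_comm (z w : DiamondVertex) : conductance s z w = conductance s w z := by
  unfold conductance; rw [min_comm]

theorem conductance_eq_edge {z w : DiamondVertex} (h : level w = level z + 1) :
    conductance s z w = edge s (level z) := by
  unfold conductance edge; rw [h]

theorem conductance_eq_edge_sub {z w : DiamondVertex} (h : level w = level z - 1) :
    conductance s z w = edge s (level z - 1) := by
  rw [conductance_comm, conductance_eq_edge (by omega), h]

theorem sum_conductance (z : DiamondVertex) : ∑ v ∈ neighbors z, conductance s z v =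
    2 * (edge s (level z) + edge s (level z - 1)) := by
  rw [sum_neighbors, conductance_eq_edge, conductance_eq_edge_sub, conductance_eq_edge,
    conductance_eq_edge_sub]
  · ring
  all_goals simp only [level]; ring

theorem stepProb_nonneg (hs : 0 ≤ s) (z w : DiamondVertex) : 0 ≤ stepProb s z w := by
  unfold stepProb
  rw [sum_conductance]
  have h1 := edge_pos hs (level z)
  have h2 := edge_pos hs (level z - 1)
  have h3 : 0 < conductance s z w := levelConductance_pos hs _
  positivity

theorem stepProb_reversible (hs : 0 ≤ s) (z w : DiamondVertex) :
    (∑ v ∈ neighbors z, conductance s z v) * stepProb s z w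
      = (∑ v ∈ neighbors w, conductance s w v) * stepProb s w z := by
  have h : ∀ z : DiamondVertex, (∑ v ∈ neighbors z, conductance s z v) ≠ 0 := fun z => by
    rw [sum_conductance]
    have h1 := edge_pos hs (level z)
    have h2 := edge_pos hs (level z - 1)
    positivity
  unfold stepProb
  rw [mul_div_cancel₀ _ (h z), mul_div_cancel₀ _ (h w), conductance_comm]

theorem survivalProb_nonneg (hs : 0 ≤ s) (t : ℕ) (z y : DiamondVertex) :
    0 ≤ survivalProb s U t z y := by
  induction t generalizing z with
  | zero => simp only [survivalProb]; split_ifs <;> norm_num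
  | succ t ih =>
    simp only [survivalProb]
    split_ifs
    · exact sum_nonneg fun w _ => mul_nonneg (stepProb_nonneg hs z w) (ih w)
    · exact le_rfl

open Classical in
theorem survivalProb_succ_right (t : ℕ) (x y : DiamondVertex) :
    survivalProb s U (t + 1) x y =
      if y ∈ U then ∑ w ∈ neighbors y, survivalProb s U t x w * stepProb s w y else 0 := by
  induction t generalizing x with
  | zero =>
    simp only [survivalProb]
    by_cases hx : x ∈ U <;> by_cases hy : y ∈ U
    · have e1 : ∀ w, (if w ∈ U ∧ w = y then (1 : ℝ) else 0) = if w = y then 1 else 0 := by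
        intro w; by_cases hw : w = y <;> simp [hw, hy]
      simp only [e1]
      simp [hx, hy, mem_neighbors_comm]
    · have e1 : ∀ w, ¬(w ∈ U ∧ w = y) := by rintro w ⟨h1, rfl⟩; exact hy h1
      simp [hy, e1]
    · simp [hx]
    · simp [hx, hy]
  | succ t ih =>
    rw [survivalProb]
    simp only [ih]
    by_cases hx : x ∈ U <;> by_cases hy : y ∈ U
    · rw [if_pos hx, if_pos hy]
      simp only [if_pos hy, mul_sum]
      rw [sum_comm]
      refine sum_congr rfl fun w _ => ?_
      rw [survivalProb, if_pos hx, sum_mul]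
      exact sum_congr rfl fun w' _ => by ring
    · simp [hy]
    · rw [if_neg hx, if_pos hy]
      refine (sum_eq_zero fun w _ => ?_).symm
      rw [survivalProb, if_neg hx, zero_mul]
    · simp [hx, hy]

theorem survivalProb_reversible (hs : 0 ≤ s) (t : ℕ) (x y : DiamondVertex) :
    (∑ v ∈ neighbors x, conductance s x v) * survivalProb s U t x y
      = (∑ v ∈ neighbors y, conductance s y v) * survivalProb s U t y x := by
  induction t generalizing x y with
  | zero =>
    simp only [survivalProb]
    by_cases h : x = y
    · rw [h]
    · simp [h, Ne.symm h]
  | succ t ih =>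
    rw [survivalProb_succ_right, survivalProb]
    split_ifs with hx
    · rw [mul_sum, mul_sum]
      refine sum_congr rfl fun w _ => ?_
      rw [← mul_assoc, ih x w]
      linear_combination survivalProb s U t w x * stepProb_reversible hs w y
    · simp

/-- All vertices of the line have the same total conductance, so reversibility becomes symmetry. The
gradient in the target can then be taken in the starting point. -/
theorem survivalProb_linePoint_comm (hs : 0 ≤ s) (t : ℕ) (x y : ℤ) :
    survivalProb s U t (linePoint x) (linePoint y)
      = survivalProb s U t (linePoint y) (linePoint x) := by
  have h := survivalProb_reversible (U := U) hs t (linePoint x) (linePoint y)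
  rw [sum_conductance, sum_conductance] at h
  simp only [linePoint, level, add_neg_cancel] at h
  have h1 := edge_pos hs 0
  have h2 := edge_pos hs (0 - 1)
  exact mul_left_cancel₀ (by positivity) h

theorem survivalProb_eq_zero_right {y : DiamondVertex} (hy : y ∉ U) (t : ℕ) (z : DiamondVertex) :
    survivalProb s U t z y = 0 := by
  cases t with
  | zero =>
    simp only [survivalProb]
    rw [if_neg]
    rintro ⟨h, rfl⟩
    exact hy h
  | succ t => rw [survivalProb_succ_right, if_neg hy]

/-- The vertex with horizontal coordinate `h / 2` and level `v`, for `h + v` even. -/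
def vertex (h v : ℤ) : DiamondVertex := ((h + v) / 2, (v - h) / 2)

/-- The survival probability in the coordinates `(h, v)`, zero off the lattice. -/
noncomputable def gridProb (s : ℝ) (U : Set DiamondVertex) (y : DiamondVertex) (t : ℕ) (h v : ℤ) :
    ℝ :=
  if Even (h + v) then survivalProb s U t (vertex h v) y else 0

theorem gridProb_linePoint (y : DiamondVertex) (t : ℕ) (x : ℤ) :
    gridProb s U y t (2 * x) 0 = survivalProb s U t (linePoint x) y := by
  unfold gridProb vertex linePoint
  rw [if_pos (by simp)]
  congr 2 <;> omega

theorem gridProb_nonneg (hs : 0 ≤ s) (y : DiamondVertex) (t : ℕ) (h v : ℤ) :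
    0 ≤ gridProb s U y t h v := by
  unfold gridProb; split_ifs
  · exact survivalProb_nonneg hs _ _ _
  · exact le_rfl

open Classical in
theorem gridProb_zero (x h v : ℤ) : gridProb s U (linePoint x) 0 h v =
    if linePoint x ∈ U ∧ h = 2 * x ∧ v = 0 then 1 else 0 := by
  unfold gridProb
  simp only [survivalProb]
  by_cases h1 : Even (h + v)
  · rw [if_pos h1]
    have : vertex h v = linePoint x ↔ h = 2 * x ∧ v = 0 := by
      obtain ⟨k, hk⟩ := h1
      simp only [vertex, linePoint, Prod.mk.injEq]
      omega
    refine if_congr ⟨fun ⟨a, b⟩ => ⟨b ▸ a, this.1 b⟩, fun ⟨a, b⟩ => ⟨?_, this.2 b⟩⟩ rfl rfl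
    rwa [this.2 b]
  · rw [if_neg h1, if_neg]
    rintro ⟨-, rfl, rfl⟩
    exact h1 (by simp)

theorem gridProb_of_notMem {y : DiamondVertex} {t : ℕ} {h v : ℤ} (hz : vertex h v ∉ U) :
    gridProb s U y t h v = 0 := by
  unfold gridProb
  split_ifs
  · cases t with
    | zero => simp only [survivalProb]; rw [if_neg]; tauto
    | succ t => simp only [survivalProb]; rw [if_neg hz]
  · rfl

/-- The conductances depend on the levels only, so given the vertical step the horizontal one is a
fair coin. Off the lattice both sides are zero. -/
theorem gridProb_succ {y : DiamondVertex} {t : ℕ} {h v : ℤ}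
    (hz : Even (h + v) → vertex h v ∈ U) : gridProb s U y (t + 1) h v =
      vertStep s Set.univ (fun w => (gridProb s U y t (h - 1) w + gridProb s U y t (h + 1) w) / 2)
        v := by
  rw [vertStep_of_mem (Set.mem_univ v)]
  by_cases he : Even (h + v)
  · have o1 : Even (h - 1 + (v + 1)) := by rw [show h - 1 + (v + 1) = h + v by ring]; exact he
    have o2 : Even (h + 1 + (v - 1)) := by rw [show h + 1 + (v - 1) = h + v by ring]; exact he
    have o3 : Even (h + 1 + (v + 1)) := by
      rw [show h + 1 + (v + 1) = h + v + 2 by ring]; exact he.add even_two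
    have o4 : Even (h - 1 + (v - 1)) := by
      rw [show h - 1 + (v - 1) = h + v - 2 by ring]; exact he.sub even_two
    simp only [gridProb, if_pos he, if_pos o1, if_pos o2, if_pos o3, if_pos o4]
    simp only [survivalProb]
    rw [if_pos (hz he), sum_neighbors]
    have hl : level (vertex h v) = v := by
      obtain ⟨k, hk⟩ := he
      simp only [level, vertex]; omega
    have e1 : ((vertex h v).1 + 1, (vertex h v).2) = vertex (h + 1) (v + 1) := by
      simp only [vertex]; ext <;> dsimp only <;> omega
    have e2 : ((vertex h v).1 - 1, (vertex h v).2) = vertex (h - 1) (v - 1) := by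
      simp only [vertex]; ext <;> dsimp only <;> omega
    have e3 : ((vertex h v).1, (vertex h v).2 + 1) = vertex (h - 1) (v + 1) := by
      simp only [vertex]; ext <;> dsimp only <;> omega
    have e4 : ((vertex h v).1, (vertex h v).2 - 1) = vertex (h + 1) (v - 1) := by
      simp only [vertex]; ext <;> dsimp only <;> omega
    have hl' : ∀ h' v' : ℤ, Even (h' + v') → level (vertex h' v') = v' := by
      rintro h' v' ⟨k, hk⟩
      simp only [level, vertex]; omega
    rw [e1, e2, e3, e4]
    simp only [stepProb, sum_conductance]
    rw [conductance_eq_edge (by rw [hl, hl' _ _ o3]),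
      conductance_eq_edge_sub (by rw [hl, hl' _ _ o4]),
      conductance_eq_edge (by rw [hl, hl' _ _ o1]),
      conductance_eq_edge_sub (by rw [hl, hl' _ _ o2]), hl]
    rw [mul_comm (2 : ℝ), ← div_div, ← div_div]
    ring
  · have o : ∀ a b : ℤ, Even (h + v + 2 * a + 2 * b) → False := fun a b hc => he (by
      have := (hc.sub (even_two_mul a)).sub (even_two_mul b)
      rwa [show h + v + 2 * a + 2 * b - 2 * a - 2 * b = h + v by ring] at this)
    have o1 : ¬Even (h - 1 + (v + 1)) := fun hc => o 0 0 (by convert hc using 1; ring)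
    have o2 : ¬Even (h + 1 + (v - 1)) := fun hc => o 0 0 (by convert hc using 1; ring)
    have o3 : ¬Even (h + 1 + (v + 1)) := fun hc => o 1 0 (by convert hc using 1; ring)
    have o4 : ¬Even (h - 1 + (v - 1)) := fun hc => o (-1) 0 (by convert hc using 1; ring)
    simp only [gridProb, if_neg he, if_neg o1, if_neg o2, if_neg o3, if_neg o4]
    simp

/-- In a domain of bounded width the survival probabilities are at most those of the strip. -/
theorem gridProb_le_heat_mul (hs : 0 ≤ s) {L : ℤ}
    (hU : ∀ h v, Even (h + v) → vertex h v ∈ U → -L < h ∧ h < L) (x : ℤ) (t : ℕ) (h v : ℤ) :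
    gridProb s U (linePoint x) t h v ≤
      heat (-L) L t h (2 * x) * (vertStep s Set.univ ^ t) (Pi.single 0 1) v := by
  have hV : ∀ t, (0 : ℤ → ℝ) ≤ (vertStep s Set.univ ^ t) (Pi.single 0 1) := fun t =>
    vertStep_pow_nonneg hs (single_nonneg 0) t
  by_cases hz : Even (h + v) → vertex h v ∈ U
  swap
  · push Not at hz
    rw [gridProb_of_notMem hz.2]
    exact mul_nonneg (heat_nonneg _ _ _) (hV t v)
  by_cases he : Even (h + v)
  swap
  · unfold gridProb
    rw [if_neg he]
    exact mul_nonneg (heat_nonneg _ _ _) (hV t v)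
  have hh := hU h v he (hz he)
  induction t generalizing h v with
  | zero =>
    rw [gridProb_zero]
    split_ifs with hc
    · obtain ⟨-, rfl, rfl⟩ := hc
      simp [heat, hh]
    · exact mul_nonneg (heat_nonneg _ _ _) (hV 0 v)
  | succ t ih =>
    have ih' : ∀ h v, gridProb s U (linePoint x) t h v ≤
        heat (-L) L t h (2 * x) * (vertStep s Set.univ ^ t) (Pi.single 0 1) v := by
      intro h v
      by_cases hz : Even (h + v) → vertex h v ∈ U
      swap
      · push Not at hz
        rw [gridProb_of_notMem hz.2]
        exact mul_nonneg (heat_nonneg _ _ _) (hV t v)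
      by_cases he : Even (h + v)
      swap
      · unfold gridProb
        rw [if_neg he]
        exact mul_nonneg (heat_nonneg _ _ _) (hV t v)
      exact ih h v hz he (hU h v he (hz he))
    rw [gridProb_succ hz]
    have hle : (fun w => (gridProb s U (linePoint x) t (h - 1) w
          + gridProb s U (linePoint x) t (h + 1) w) / 2) ≤
        ((heat (-L) L t (h - 1) (2 * x) + heat (-L) L t (h + 1) (2 * x)) / 2) •
          (vertStep s Set.univ ^ t) (Pi.single 0 1) := by
      intro w
      simp only [Pi.smul_apply, smul_eq_mul]
      linarith [ih' (h - 1) w, ih' (h + 1) w]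
    refine (vertStep_mono hs hle v).trans (le_of_eq ?_)
    rw [map_smul, pow_succ', Module.End.mul_apply, heat, if_pos hh]
    rfl

/-- The expected number of visits to `y` up to time `T`, in the coordinates `(h, v)`. -/
noncomputable def gridGreen (s : ℝ) (U : Set DiamondVertex) (y : DiamondVertex) (T : ℕ) (h : ℤ) :
    ℤ → ℝ :=
  fun v => ∑ t ∈ range (T + 1), gridProb s U y t h v

theorem gridGreen_nonneg (hs : 0 ≤ s) (y : DiamondVertex) (T : ℕ) (h v : ℤ) :
    0 ≤ gridGreen s U y T h v := sum_nonneg fun t _ => gridProb_nonneg hs y t h v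

theorem gridGreen_of_notMem {y : DiamondVertex} {T : ℕ} {h v : ℤ} (hz : vertex h v ∉ U) :
    gridGreen s U y T h v = 0 := sum_eq_zero fun _ _ => gridProb_of_notMem hz

theorem gridGreen_of_odd {y : DiamondVertex} {T : ℕ} {h v : ℤ} (hz : ¬Even (h + v)) :
    gridGreen s U y T h v = 0 := sum_eq_zero fun _ _ => by unfold gridProb; rw [if_neg hz]

theorem gridGreen_succ {y : DiamondVertex} {T : ℕ} {h v : ℤ}
    (hz : Even (h + v) → vertex h v ∈ U) : gridGreen s U y (T + 1) h v = gridProb s U y 0 h v +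
      vertStep s Set.univ ((1 / 2 : ℝ) • (gridGreen s U y T (h - 1) + gridGreen s U y T (h + 1)))
        v := by
  unfold gridGreen
  rw [sum_range_succ', add_comm]
  congr 1
  simp only [gridProb_succ hz]
  rw [← Finset.sum_apply v _ fun t => vertStep s Set.univ (fun w => (gridProb s U y t (h - 1) w
    + gridProb s U y t (h + 1) w) / 2), ← map_sum]
  refine congrArg (fun f => vertStep s Set.univ f v) (funext fun w => ?_)
  simp only [Finset.sum_apply, Pi.smul_apply, Pi.add_apply, smul_eq_mul]
  rw [← sum_add_distrib, mul_sum]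
  exact sum_congr rfl fun t _ => by ring

/-- Maximum principle again: off the pole the sum is an average of neighbouring sums over a shorter
time. -/
theorem gridGreen_le_diag (hs : 0 ≤ s) (x : ℤ) (T : ℕ) (h v : ℤ) :
    gridGreen s U (linePoint x) T h v ≤ gridGreen s U (linePoint x) T (2 * x) 0 := by
  by_cases hz : Even (h + v) → vertex h v ∈ U
  swap
  · push Not at hz
    rw [gridGreen_of_notMem hz.2]
    exact gridGreen_nonneg hs _ _ _ _
  induction T generalizing h v with
  | zero =>
    simp only [gridGreen, zero_add, sum_range_one, gridProb_zero]
    split_ifs <;> first | tauto | norm_num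
  | succ T ih =>
    have ih' : ∀ h v, gridGreen s U (linePoint x) T h v ≤
        gridGreen s U (linePoint x) T (2 * x) 0 := by
      intro h v
      by_cases hz : Even (h + v) → vertex h v ∈ U
      · exact ih h v hz
      · push Not at hz
        rw [gridGreen_of_notMem hz.2]
        exact gridGreen_nonneg hs _ _ _ _
    have hmono : gridGreen s U (linePoint x) T (2 * x) 0 ≤
        gridGreen s U (linePoint x) (T + 1) (2 * x) 0 := by
      unfold gridGreen
      rw [sum_range_succ _ (T + 1)]
      linarith [gridProb_nonneg (U := U) hs (linePoint x) (T + 1) (2 * x) 0]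
    by_cases hxv : h = 2 * x ∧ v = 0
    · rw [hxv.1, hxv.2]
    rw [gridGreen_succ hz, gridProb_zero, if_neg (by tauto), zero_add]
    refine le_trans ?_ hmono
    refine vertStep_le hs (gridGreen_nonneg hs _ _ _ _) ?_ ?_
    · simp only [Pi.smul_apply, Pi.add_apply, smul_eq_mul]
      linarith [ih' (h - 1) (v + 1), ih' (h + 1) (v + 1)]
    · simp only [Pi.smul_apply, Pi.add_apply, smul_eq_mul]
      linarith [ih' (h - 1) (v - 1), ih' (h + 1) (v - 1)]

/-- In a domain of width `L` the Green function is at most of order `L ^ b` for every `b > s`. -/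
theorem gridGreen_le (hs0 : 0 ≤ s) (hs1 : s ≤ 1) {b : ℝ} (hb0 : 0 < b) (hb1 : b ≤ 1)
    (hsb : s ≤ b) {L : ℕ} (hU : ∀ h v, Even (h + v) → vertex h v ∈ U → -(L : ℤ) < h ∧ h < L)
    (x : ℤ) (T : ℕ) (h v : ℤ) :
    gridGreen s U (linePoint x) T h v ≤ 240 / b * (L : ℝ) ^ b := by
  refine (gridGreen_le_diag hs0 x T h v).trans ?_
  by_cases hx : -(L : ℤ) < 2 * x ∧ 2 * x < L
  swap
  · have : gridGreen s U (linePoint x) T (2 * x) 0 = 0 :=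
      gridGreen_of_notMem fun hc => hx (hU _ _ (by simp) hc)
    rw [this]; positivity
  set r := returnBound s Set.univ with hr
  set g : ℤ → ℝ := fun y => ∑ k ∈ range (T + 1), r k * heat (-(L : ℤ)) L k (2 * x) (2 * y) with hg
  have h1 : gridGreen s U (linePoint x) T (2 * x) 0 ≤ g x := by
    refine sum_le_sum fun t _ => (gridProb_le_heat_mul hs0 hU x t (2 * x) 0).trans ?_
    rw [mul_comm]
    exact mul_le_mul_of_nonneg_right (vertStep_pow_single_le hs0 isCentered_univ t 0)
      (heat_nonneg _ _ _)
  -- The majorant `g` vanishes at `x + L`, so its value at `x` is a telescoping sum of gradients.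
  -- Passing from exponent `s - 1` to `b - 1` with `b > 0` covers the logarithmic case `s = 0`; `240
  -- = 4 * 12 * 5`.
  have h2 : ∀ i : ℕ, g (x + i) - g (x + (i + 1 : ℕ)) ≤ 240 * ((i : ℝ) + 1) ^ (b - 1) := by
    intro i
    have hgrad := abs_sum_mul_heat_sub_le (N := (L : ℤ)) (r := r)
      (returnBound_antitone hs0 isCentered_univ)
      (returnBound_nonneg hs0) (a := (1 - s) / 2) (by linarith) (by linarith)
      (returnBound_le hs0 hs1) T x (x + i)
    have e : ∑ k ∈ range (T + 1), r k * (heat (-(L : ℤ)) L k (2 * x) (2 * (x + i + 1))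
        - heat (-(L : ℤ)) L k (2 * x) (2 * (x + i))) = g (x + (i + 1 : ℕ)) - g (x + i) := by
      simp only [hg, mul_sub, sum_sub_distrib]
      push_cast
      ring_nf
    rw [e, abs_sub_comm] at hgrad
    refine (le_abs_self _).trans (hgrad.trans ?_)
    have hi : (0 : ℝ) ≤ i := Nat.cast_nonneg i
    have e2 : |(x : ℝ) - ((x + i : ℤ) : ℝ)| = i := by
      push_cast
      rw [show (x : ℝ) - (x + i) = -i by ring, abs_neg, abs_of_nonneg hi]
    rw [e2, Real.div_rpow (by positivity) (by norm_num), ← Real.rpow_natCast,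
      ← Real.rpow_mul (by positivity), show ((2 : ℕ) : ℝ) * -((1 - s) / 2) = s - 1 by
        push_cast; ring, Real.rpow_neg (by norm_num : (0 : ℝ) ≤ 5), div_inv_eq_mul]
    have h5 : (5 : ℝ) ^ ((1 - s) / 2) ≤ 5 ^ (1 : ℝ) :=
      Real.rpow_le_rpow_of_exponent_le (by norm_num) (by linarith)
    rw [Real.rpow_one] at h5
    have h6 : ((i : ℝ) + 1) ^ (s - 1) ≤ ((i : ℝ) + 1) ^ (b - 1) :=
      Real.rpow_le_rpow_of_exponent_le (by linarith) (by linarith)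
    have h7 : ((i : ℝ) + 1) ^ (s - 1) * 5 ^ ((1 - s) / 2) ≤ ((i : ℝ) + 1) ^ (b - 1) * 5 := by
      gcongr
    linarith
  have h3 : g (x + L) = 0 := sum_eq_zero fun k _ => by
    rw [heat_comm, heat_eq_zero_left _ _ (by omega), mul_zero]
  have h4 : ∑ i ∈ range L, (g (x + i) - g (x + (i + 1 : ℕ))) = g x - g (x + L) := by
    have := sum_range_sub' (fun i : ℕ => g (x + i)) L
    simpa using this
  have h5 := sum_le_sum fun i (_ : i ∈ range L) => h2 i
  rw [h4, h3, sub_zero, ← mul_sum] at h5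
  have h6 := sum_rpow_le hb0 hb1 L
  calc _ ≤ _ := h1
    _ ≤ _ := h5
    _ ≤ 240 * ((L : ℝ) ^ b / b) := by gcongr
    _ = _ := by ring

end SlitWalk

/-! ### Geometry of the smoothed domain. -/

namespace SlitWalk
open Finset Diamond

theorem norm_position (z : DiamondVertex) :
    ‖position z‖ = max (|((z.1 - z.2 : ℤ) : ℝ)| / 2) (|((z.1 + z.2 : ℤ) : ℝ)| / 2) := by
  simp [position, Prod.norm_def]

theorem dist_position_linePoint (z : DiamondVertex) (k : ℤ) :
    dist (position z) (position (linePoint k)) =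
      max |((z.1 - z.2 : ℤ) : ℝ) / 2 - k| (|((z.1 + z.2 : ℤ) : ℝ)| / 2) := by
  simp only [position, linePoint, Prod.dist_eq, Real.dist_eq]
  push_cast
  congr 2
  · ring
  · rw [show ((z.1 : ℝ) + z.2) / 2 - (k + -k) / 2 = (z.1 + z.2) / 2 by ring, abs_div, abs_two]

theorem vertex_fst_sub_snd {h v : ℤ} (he : Even (h + v)) :
    (vertex h v).1 - (vertex h v).2 = h := by
  obtain ⟨k, hk⟩ := he
  simp only [vertex]; omega

theorem vertex_fst_add_snd {h v : ℤ} (he : Even (h + v)) :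
    (vertex h v).1 + (vertex h v).2 = v := by
  obtain ⟨k, hk⟩ := he
  simp only [vertex]; omega

theorem distSlit_le {n : ℕ} {z : DiamondVertex} {k : ℤ} (hk : (n : ℤ) + 1 ≤ |k|) {c : ℝ}
    (h1 : |((z.1 - z.2 : ℤ) : ℝ) / 2 - k| ≤ c) (h2 : |((z.1 + z.2 : ℤ) : ℝ)| / 2 ≤ c) :
    distSlit n z ≤ c := by
  refine (Metric.infDist_le_dist_of_mem (Set.mem_image_of_mem position
    (Set.mem_image_of_mem linePoint
      (show k ∈ {k : ℤ | (n : ℤ) + 1 ≤ |k|} from hk)))).trans ?_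
  rw [dist_position_linePoint]
  exact max_le h1 h2

theorem mem_liveDomain_iff {n : ℕ} {M : ℝ} (hn : 0 < 1 / M * n) {z : DiamondVertex} :
    z ∈ liveDomain n M ↔ ‖position z‖ < M * n ∧ 1 / M * n < distSlit n z := by
  constructor
  · rintro ⟨⟨h1, h2, h3⟩, h4⟩
    have h5 : ¬(‖position z‖ = M * n ∨ distSlit n z = 1 / M * n) :=
      fun h => h4 ⟨⟨h1, h2, h3⟩, h⟩
    push Not at h5
    exact ⟨lt_of_le_of_ne h2 h5.1, lt_of_le_of_ne h3 h5.2.symm⟩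
  · rintro ⟨h1, h2⟩
    refine ⟨⟨?_, h1.le, h2.le⟩, ?_⟩
    · intro hz
      have : distSlit n z = 0 := Metric.infDist_zero_of_mem (Set.mem_image_of_mem position hz)
      linarith
    · rintro ⟨-, h | h⟩ <;> linarith

/-- Half the width of the box `‖z‖ < M n`, in the coordinates `(h, v)`. -/
noncomputable def boxWidth (n : ℕ) (M : ℝ) : ℕ := ⌈2 * M * n⌉₊

/-- Half the width of the strip between the two parts of the thickened slit. -/
noncomputable def gapWidth (n : ℕ) (M : ℝ) : ℤ := ⌈2 * ((n : ℝ) + 1) - 2 * n / M⌉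

section domain
variable {n : ℕ} {M : ℝ} {h v : ℤ}

theorem pos_radius (hM : 1 ≤ M) (hn : 1 ≤ n) : 0 < 1 / M * n := by
  have : (1 : ℝ) ≤ n := by exact_mod_cast hn
  positivity

theorem abs_lt_boxWidth {h : ℤ} : |(h : ℝ)| < 2 * M * n ↔ |h| < (boxWidth n M : ℤ) := by
  unfold boxWidth
  have e : |(h : ℝ)| = ((h.natAbs : ℕ) : ℝ) := by rw [Nat.cast_natAbs]; push_cast; rfl
  rw [e, ← Nat.lt_ceil, Int.abs_eq_natAbs]
  omega

theorem abs_lt_gapWidth {h : ℤ} :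
    |(h : ℝ)| < 2 * ((n : ℝ) + 1) - 2 * n / M ↔ |h| < gapWidth n M := by
  unfold gapWidth
  rw [Int.lt_ceil]
  push_cast
  rfl

theorem gapWidth_le : 1 ≤ M → gapWidth n M ≤ 2 * (n + 1) := by
  intro hM
  unfold gapWidth
  rw [Int.ceil_le]
  push_cast
  have : 0 ≤ 2 * (n : ℝ) / M := by positivity
  linarith

theorem le_gapWidth : 2 * ((n : ℝ) + 1) - 2 * n / M ≤ gapWidth n M := Int.le_ceil _

theorem gapWidth_pos (hM : 1 ≤ M) : 0 < gapWidth n M := by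
  unfold gapWidth
  rw [Int.ceil_pos]
  have hn : (0 : ℝ) ≤ n := Nat.cast_nonneg n
  have : 2 * (n : ℝ) / M ≤ 2 * n := div_le_self (by positivity) hM
  linarith

theorem abs_lt_boxWidth_of_mem (hM : 1 ≤ M) (hn : 1 ≤ n) (he : Even (h + v))
    (hz : vertex h v ∈ liveDomain n M) :
    |h| < (boxWidth n M : ℤ) ∧ |v| < (boxWidth n M : ℤ) := by
  have h1 := ((mem_liveDomain_iff (pos_radius hM hn)).1 hz).1
  rw [norm_position, vertex_fst_sub_snd he, vertex_fst_add_snd he, max_lt_iff] at h1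
  constructor <;> rw [← abs_lt_boxWidth] <;> linarith [h1.1, h1.2]

/-- The horizontal distance to the slit alone exceeds `n / M` in the gap. The gap fits in the box
because `M + 1 / M ≥ 2`. -/
theorem mem_liveDomain (hM : 1 ≤ M) (hn : 1 ≤ n) (he : Even (h + v))
    (hh : |h| < gapWidth n M) (hv : |v| < (boxWidth n M : ℤ)) :
    vertex h v ∈ liveDomain n M := by
  rw [mem_liveDomain_iff (pos_radius hM hn)]
  rw [← abs_lt_gapWidth] at hh
  rw [← abs_lt_boxWidth] at hv
  have hn' : (1 : ℝ) ≤ n := by exact_mod_cast hn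
  have e : 2 * (n : ℝ) / M = 2 * (1 / M * n) := by ring
  constructor
  · rw [norm_position, vertex_fst_sub_snd he, vertex_fst_add_snd he, max_lt_iff]
    refine ⟨?_, by linarith⟩
    have h3 : (n : ℝ) + 1 - 1 / M * n ≤ M * n := by
      have hM0 : 0 < M := by linarith
      have h4 : 2 - M ≤ 1 / M := by
        rw [le_div_iff₀ hM0]; nlinarith [sq_nonneg (M - 1)]
      nlinarith
    rw [e] at hh
    linarith
  · have hne : (position '' slit n).Nonempty := by
      refine ⟨_, Set.mem_image_of_mem position (Set.mem_image_of_mem linePoint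
        (show (n : ℤ) + 1 ≤ |(n : ℤ) + 1| from le_abs_self _))⟩
    have h5 : (n : ℝ) + 1 - |(h : ℝ)| / 2 ≤ distSlit n (vertex h v) := by
      unfold distSlit
      rw [Metric.le_infDist hne]
      rintro _ ⟨_, ⟨k, hk, rfl⟩, rfl⟩
      rw [dist_position_linePoint, vertex_fst_sub_snd he]
      refine le_trans ?_ (le_max_left _ _)
      have hk' : (n : ℝ) + 1 ≤ |(k : ℝ)| := by
        have : (n : ℤ) + 1 ≤ |k| := hk
        exact_mod_cast this
      have h6 := abs_sub_abs_le_abs_sub (k : ℝ) ((h : ℝ) / 2)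
      rw [abs_sub_comm, abs_div, abs_two] at h6
      linarith
    rw [e] at hh
    linarith

/-- On the vertical lines that bound the gap, the live vertices lie above the thickened slit. -/
theorem lt_abs_of_mem_of_abs_eq (hM : 1 ≤ M) (hn : 1 ≤ n) (he : Even (h + v))
    (hh : |h| = gapWidth n M) (hz : vertex h v ∈ liveDomain n M) : 2 * n / M < |(v : ℝ)| := by
  have h1 := ((mem_liveDomain_iff (pos_radius hM hn)).1 hz).2
  by_contra! hc
  refine absurd h1 (not_lt.2 ?_)
  have e : 2 * (n : ℝ) / M = 2 * (1 / M * n) := by ring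
  have a1 : (gapWidth n M : ℝ) ≤ 2 * (n + 1) := by
    exact_mod_cast gapWidth_le (n := n) hM
  have a2 := le_gapWidth (n := n) (M := M)
  rw [e] at hc a2
  have hnn : (n : ℤ) + 1 ≤ |(n : ℤ) + 1| := le_abs_self _
  -- The slit endpoint on the same side is within horizontal distance `n / M`, rounding included; at
  -- low levels it would be too close.
  rcases le_total 0 h with h0 | h0
  · rw [abs_of_nonneg h0] at hh
    refine distSlit_le hnn ?_ ?_
    · rw [vertex_fst_sub_snd he, hh]
      push_cast
      rw [abs_le]; constructor <;> linarith
    · rw [vertex_fst_add_snd he]; linarith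
  · rw [abs_of_nonpos h0] at hh
    refine distSlit_le (k := -((n : ℤ) + 1)) (by rwa [abs_neg]) ?_ ?_
    · rw [vertex_fst_sub_snd he, show h = -gapWidth n M by omega]
      push_cast
      rw [abs_le]; constructor <;> linarith
    · rw [vertex_fst_add_snd he]; linarith

/-- The live points of the line lie in the gap. -/
theorem abs_lt_of_mem (hM : 1 ≤ M) (hn : 1 ≤ n) {x : ℤ} (hx : linePoint x ∈ liveDomain n M) :
    |2 * x| < gapWidth n M := by
  have h1 := ((mem_liveDomain_iff (pos_radius hM hn)).1 hx).2
  by_contra! hc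
  refine absurd h1 (not_lt.2 ?_)
  have a2 := le_gapWidth (n := n) (M := M)
  rw [show 2 * (n : ℝ) / M = 2 * (1 / M * n) by ring] at a2
  have hp := pos_radius hM hn
  by_cases hxn : (n : ℤ) + 1 ≤ |x|
  · refine distSlit_le hxn ?_ ?_
    · simp only [linePoint]
      push_cast
      rw [show ((x : ℝ) - -x) / 2 - x = 0 by ring, abs_zero]
      exact hp.le
    · simp only [linePoint, add_neg_cancel, Int.cast_zero, abs_zero, zero_div]
      exact hp.le
  · have hnn : (n : ℤ) + 1 ≤ |(n : ℤ) + 1| := le_abs_self _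
    have hc' : (gapWidth n M : ℝ) ≤ 2 * |(x : ℝ)| := by
      have : gapWidth n M ≤ 2 * |x| := by rwa [abs_mul, abs_two] at hc
      exact_mod_cast this
    have hxn' : |(x : ℝ)| < n + 1 := by exact_mod_cast not_le.1 hxn
    rcases le_total 0 x with h0 | h0
    · have h0' : (0 : ℝ) ≤ x := by exact_mod_cast h0
      rw [abs_of_nonneg h0'] at hc' hxn'
      refine distSlit_le hnn ?_ ?_
      · simp only [linePoint]
        push_cast
        rw [abs_le]; constructor <;> linarith
      · simp only [linePoint, add_neg_cancel, Int.cast_zero, abs_zero, zero_div]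
        exact hp.le
    · have h0' : (x : ℝ) ≤ 0 := by exact_mod_cast h0
      rw [abs_of_nonpos h0'] at hc' hxn'
      refine distSlit_le (k := -((n : ℤ) + 1)) (by rwa [abs_neg]) ?_ ?_
      · simp only [linePoint]
        push_cast
        rw [abs_le]; constructor <;> linarith
      · simp only [linePoint, add_neg_cancel, Int.cast_zero, abs_zero, zero_div]
        exact hp.le

end domain

/-! ### The gradient estimate for the smoothed domain. -/

section gradient
variable {s M : ℝ} {n : ℕ}

theorem gridGreen_liveDomain_le (hs0 : 0 ≤ s) (hs1 : s ≤ 1) {b : ℝ} (hb0 : 0 < b) (hb1 : b ≤ 1)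
    (hsb : s ≤ b) (hM : 1 ≤ M) (hn : 1 ≤ n) (x : ℤ) (T : ℕ) (h v : ℤ) :
    gridGreen s (liveDomain n M) (linePoint x) T h v ≤ 720 * M / b * (n : ℝ) ^ b := by
  have hU : ∀ h v, Even (h + v) → vertex h v ∈ liveDomain n M →
      -(boxWidth n M : ℤ) < h ∧ h < boxWidth n M := fun h v he hz =>
    abs_lt.1 (abs_lt_boxWidth_of_mem hM hn he hz).1
  refine (gridGreen_le hs0 hs1 hb0 hb1 hsb hU x T h v).trans ?_
  have hn' : (1 : ℝ) ≤ n := by exact_mod_cast hn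
  have hL : (boxWidth n M : ℝ) ≤ 3 * M * n := by
    have := (Nat.ceil_lt_add_one (show 0 ≤ 2 * M * n by positivity)).le
    have h2 : 1 ≤ M * n := by nlinarith
    unfold boxWidth
    linarith
  have h1 : (boxWidth n M : ℝ) ^ b ≤ (3 * M) * (n : ℝ) ^ b := by
    calc (boxWidth n M : ℝ) ^ b ≤ (3 * M * n) ^ b := Real.rpow_le_rpow (by positivity) hL hb0.le
      _ = (3 * M) ^ b * (n : ℝ) ^ b := Real.mul_rpow (by positivity) (by positivity)
      _ ≤ (3 * M) ^ (1 : ℝ) * (n : ℝ) ^ b := by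
          gcongr
          linarith
      _ = _ := by rw [Real.rpow_one]
  calc 240 / b * (boxWidth n M : ℝ) ^ b ≤ 240 / b * ((3 * M) * (n : ℝ) ^ b) := by gcongr
    _ = _ := by ring

/-- The Green function on the line, decomposed at the exit from the gap. -/
theorem gridGreen_line_eq (hM : 1 ≤ M) (hn : 1 ≤ n) (x : ℤ) (hx : |2 * x| < gapWidth n M)
    (T : ℕ) (h : ℤ) (he : Even h) :
    gridGreen s (liveDomain n M) (linePoint x) T h 0 = ∑ k ∈ range (T + 1),
      (heat (-gapWidth n M) (gapWidth n M) k h (2 * x)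
          * returnProb s {v | |v| < (boxWidth n M : ℤ)} k
        + evolve (-gapWidth n M) (gapWidth n M) (Pi.single (-gapWidth n M) 1) k h
          * (vertStep s {v | |v| < (boxWidth n M : ℤ)} ^ k)
            (gridGreen s (liveDomain n M) (linePoint x) (T - k) (-gapWidth n M)) 0
        + evolve (-gapWidth n M) (gapWidth n M) (Pi.single (gapWidth n M) 1) k h
          * (vertStep s {v | |v| < (boxWidth n M : ℤ)} ^ k)
            (gridGreen s (liveDomain n M) (linePoint x) (T - k) (gapWidth n M)) 0) := by
  set N := gapWidth n M with hN
  set V : Set ℤ := {v | |v| < (boxWidth n M : ℤ)} with hV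
  set F := gridGreen s (liveDomain n M) (linePoint x) with hF
  have hNpos : 0 < N := gapWidth_pos hM
  have hL : 0 < boxWidth n M := by
    have hn' : (1 : ℝ) ≤ n := by exact_mod_cast hn
    exact Nat.ceil_pos.2 (by positivity)
  have hxl : linePoint x ∈ liveDomain n M := by
    have := mem_liveDomain (h := 2 * x) (v := 0) hM hn (by simp) hx (by simpa using hL)
    convert this using 1
    simp only [vertex, linePoint]
    ext <;> dsimp only <;> omega
  have hsrc : ∀ h v, gridProb s (liveDomain n M) (linePoint x) 0 h v =
      (if h = 2 * x then (Pi.single 0 1 : ℤ → ℝ) else 0) v := by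
    intro h v
    rw [gridProb_zero]
    by_cases h1 : h = 2 * x
    · simp [h1, hxl, Pi.single_apply]
    · simp [h1]
  have hrep : ∀ T h, -N ≤ h → h ≤ N → F T h = ∑ k ∈ range (T + 1),
      (heat (-N) N k h (2 * x) • (vertStep s V ^ k) (Pi.single 0 1)
        + evolve (-N) N (Pi.single (-N) 1) k h • (vertStep s V ^ k) (F (T - k) (-N))
        + evolve (-N) N (Pi.single N 1) k h • (vertStep s V ^ k) (F (T - k) N)) := by
    intro T h h1 h2
    refine eq_sum_heat_add_sum_evolve (vertStep s V) (Pi.single 0 1) (2 * x) F (by omega) ?_ ?_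
      T h h1 h2
    · intro h _ _
      ext v
      simp only [hF, gridGreen, zero_add, sum_range_one]
      exact hsrc h v
    · intro T h h1 h2
      ext v
      rw [← map_smul, Pi.add_apply, ← hsrc]
      -- Inside the gap a vertex is alive exactly when its level is in `V`, so the killed step is a
      -- product. At levels outside `V` both sides vanish.
      by_cases hv : v ∈ V
      · have hin : Even (h + v) → vertex h v ∈ liveDomain n M := fun he =>
          mem_liveDomain hM hn he (abs_lt.2 ⟨h1, h2⟩) hv
        rw [hF, gridGreen_succ hin, vertStep_of_mem hv, vertStep_of_mem (Set.mem_univ v)]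
      · rw [vertStep_of_notMem hv, hsrc]
        have hv0 : v ≠ 0 := by
          rintro rfl
          exact hv (by simpa [hV] using hL)
        have e1 : F (T + 1) h v = 0 := by
          by_cases he : Even (h + v)
          · exact gridGreen_of_notMem fun hz => hv (abs_lt_boxWidth_of_mem hM hn he hz).2
          · exact gridGreen_of_odd he
        rw [e1]
        split_ifs <;> simp [hv0]
  by_cases hh : -N ≤ h ∧ h ≤ N
  · rw [hrep T h hh.1 hh.2]
    simp only [Finset.sum_apply, Pi.add_apply, Pi.smul_apply, smul_eq_mul, returnProb]
  · have e1 : F T h 0 = 0 := by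
      refine gridGreen_of_notMem fun hz => ?_
      obtain ⟨y, rfl⟩ := he
      have e2 : vertex (y + y) 0 = linePoint y := by
        simp only [vertex, linePoint]
        ext <;> dsimp only <;> omega
      rw [e2] at hz
      have := abs_lt_of_mem hM hn hz
      rw [← hN, abs_lt] at this
      omega
    rw [e1, eq_comm]
    refine sum_eq_zero fun k _ => ?_
    have e2 : ∀ w, w = N ∨ w = -N → evolve (-N) N (Pi.single w 1) k h = 0 := by
      intro w hw
      cases k with
      | zero => simp only [evolve, Pi.single_apply]; rw [if_neg (by omega)]
      | succ k => exact evolve_succ_of_not_mem _ _ (by omega)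
    rw [heat_eq_zero_left _ _ (by omega), e2 _ (Or.inl rfl), e2 _ (Or.inr rfl)]
    ring

/-- The boundary values grow at most linearly in time. -/
theorem vertStep_pow_gridGreen_le (hs : 0 ≤ s) {F : ℝ} (hF0 : 0 ≤ F) (hM : 1 ≤ M)
    (hn : 1 ≤ n) (x : ℤ) (T : ℕ)
    (hF : ∀ h v, gridGreen s (liveDomain n M) (linePoint x) T h v ≤ F) {m : ℕ} (hm : 0 < m)
    (hmn : (m : ℝ) ≤ (2 * n / M) ^ 2) {w : ℤ} (hw : |w| = gapWidth n M) (V : Set ℤ) (k : ℕ) :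
    (vertStep s V ^ k) (gridGreen s (liveDomain n M) (linePoint x) T w) 0 ≤ F ∧
    (vertStep s V ^ k) (gridGreen s (liveDomain n M) (linePoint x) T w) 0 ≤ F * (k / m) := by
  set g := gridGreen s (liveDomain n M) (linePoint x) T w with hg
  have hg0 : 0 ≤ g := fun v => gridGreen_nonneg hs _ _ _ _
  have hm0 : (0 : ℝ) < m := by exact_mod_cast hm
  have h1 : g ≤ F • (1 : ℤ → ℝ) := fun v => by
    simpa using hF w v
  have h2 : g ≤ (F / m) • fun v : ℤ => (v : ℝ) ^ 2 := by
    -- Chebyshev: on the line `h = w` the Green function is zero wherever `v ^ 2 < m`, so `F * v ^ 2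
    -- / m` dominates it, and from level zero the second moment at time `k` is at most `k`.
    intro v
    simp only [Pi.smul_apply, smul_eq_mul]
    by_cases hz : Even (w + v) ∧ vertex w v ∈ liveDomain n M
    · have h3 := lt_abs_of_mem_of_abs_eq hM hn hz.1 hw hz.2
      have h4 : (m : ℝ) ≤ (v : ℝ) ^ 2 := by
        rw [← sq_abs (v : ℝ)]
        refine hmn.trans ?_
        gcongr
      calc g v ≤ F := hF w v
        _ = F / m * m := by field_simp
        _ ≤ F / m * (v : ℝ) ^ 2 := by gcongr
    · have : g v = 0 := by
        by_cases he : Even (w + v)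
        · exact gridGreen_of_notMem fun hc => hz ⟨he, hc⟩
        · exact gridGreen_of_odd he
      rw [this]; positivity
  constructor
  · refine (vertStep_pow_le_univ hs hg0 k 0).trans ((vertStep_pow_mono hs h1 k 0).trans ?_)
    rw [map_smul, vertStep_univ_pow_one hs]
    simp
  · refine (vertStep_pow_le_univ hs hg0 k 0).trans ((vertStep_pow_mono hs h2 k 0).trans ?_)
    rw [map_smul]
    have := vertStep_pow_sq_le hs k 0
    simp only [Pi.smul_apply, smul_eq_mul]
    calc F / m * (vertStep s Set.univ ^ k) (fun v : ℤ => (v : ℝ) ^ 2) 0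
        ≤ F / m * (((0 : ℤ) : ℝ) ^ 2 + k) := by gcongr
      _ = F * (k / m) := by simp; ring

/-- The gradient of the Green function up to time `T`, when the slit is thickened. -/
theorem abs_gridGreen_sub_le (hs0 : 0 ≤ s) (hs1 : s ≤ 1) (hM : 1 ≤ M) (hn : 1 ≤ n) {F : ℝ}
    (hF0 : 0 ≤ F) {m : ℕ} (hm : 0 < m) (hmn : (m : ℝ) ≤ (2 * n / M) ^ 2) (x : ℤ)
    (hF : ∀ T h v, gridGreen s (liveDomain n M) (linePoint x) T h v ≤ F) (T : ℕ) (y : ℤ) :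
    |gridGreen s (liveDomain n M) (linePoint x) T (2 * (y + 1)) 0
        - gridGreen s (liveDomain n M) (linePoint x) T (2 * y) 0|
      ≤ 48 * ((|(x : ℝ) - y| + 1) ^ 2 / 5) ^ (-((1 - s) / 2))
        + 192 * F * (m : ℝ) ^ (-(1 / 2 : ℝ)) := by
  by_cases hx : |2 * x| < gapWidth n M
  swap
  · have h0 : ∀ h v, gridGreen s (liveDomain n M) (linePoint x) T h v = 0 := fun h v =>
      sum_eq_zero fun t _ => by
        unfold gridProb
        rw [survivalProb_eq_zero_right fun hc => hx (abs_lt_of_mem hM hn hc)]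
        simp
    rw [h0, h0, sub_zero, abs_zero]
    positivity
  rw [gridGreen_line_eq hM hn x hx T _ (even_two_mul _),
    gridGreen_line_eq hM hn x hx T _ (even_two_mul _), ← sum_sub_distrib]
  set N := gapWidth n M with hN
  have hNpos : 0 < N := gapWidth_pos hM
  set V : Set ℤ := {v | |v| < (boxWidth n M : ℤ)} with hV
  have hV' : IsCentered V := isCentered_abs_lt _
  set φ : ℤ → ℕ → ℝ := fun w k => (vertStep s V ^ k)
    (gridGreen s (liveDomain n M) (linePoint x) (T - k) w) 0 with hφ
  have hφ0 : ∀ w k, 0 ≤ φ w k := fun w k =>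
    vertStep_pow_nonneg hs0 (fun v => gridGreen_nonneg hs0 _ _ _ _) k 0
  have hu : ∀ w, |w| = N → |∑ k ∈ range (T + 1), (evolve (-N) N (Pi.single w 1) k (2 * y + 2)
      - evolve (-N) N (Pi.single w 1) k (2 * y)) * φ w k| ≤ 96 * F * (m : ℝ) ^ (-(1 / 2 : ℝ)) := by
    intro w hw
    refine (abs_sum_le_sum_abs _ _).trans ?_
    refine le_trans (le_of_eq ?_) (sum_abs_evolve_single_sub_mul_le (N := N) (w := w)
      (c := φ w) (fun hc => by rw [← abs_lt] at hc; omega) hF0 hm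
      (fun k => (vertStep_pow_gridGreen_le hs0 hF0 hM hn x _ (hF _) hm hmn hw V k).1)
      (fun k => (vertStep_pow_gridGreen_le hs0 hF0 hM hn x _ (hF _) hm hmn hw V k).2)
      (T + 1) (2 * y))
    exact sum_congr rfl fun k _ => by rw [abs_mul, abs_of_nonneg (hφ0 w k)]
  have h1 := hu N (abs_of_pos hNpos)
  have h2 := hu (-N) (by rw [abs_neg, abs_of_pos hNpos])
  have h3 := abs_sum_mul_heat_sub_le (N := N) (returnBound_antitone hs0 hV')
      (returnBound_nonneg hs0) (a := (1 - s) / 2) (by linarith) (by linarith)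
      (returnBound_le hs0 hs1) T x y
  -- The antitone majorant differs from the return probability only at odd times, when the heat
  -- kernel between even points is zero.
  have e3 : ∑ k ∈ range (T + 1), returnBound s V k
        * (heat (-N) N k (2 * x) (2 * (y + 1)) - heat (-N) N k (2 * x) (2 * y)) =
      ∑ k ∈ range (T + 1), (heat (-N) N k (2 * (y + 1)) (2 * x)
        - heat (-N) N k (2 * y) (2 * x)) * returnProb s V k := by
    refine sum_congr rfl fun k _ => ?_
    rw [heat_comm k (2 * x), heat_comm k (2 * x)]
    rcases Nat.even_or_odd k with hk | hk
    · rw [returnBound_of_even hk]; ring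
    · have hk' : Odd (k : ℤ) := by exact_mod_cast hk
      rw [heat_eq_zero_of_odd k ((hk'.add_even (even_two_mul _)).add_even (even_two_mul _)),
        heat_eq_zero_of_odd k ((hk'.add_even (even_two_mul _)).add_even (even_two_mul _))]
      ring
  rw [e3] at h3
  have e : ∀ A B C : ℝ, |A| ≤ 4 * 12 * ((|(x : ℝ) - y| + 1) ^ 2 / 5) ^ (-((1 - s) / 2)) →
      |B| ≤ 96 * F * (m : ℝ) ^ (-(1 / 2 : ℝ)) → |C| ≤ 96 * F * (m : ℝ) ^ (-(1 / 2 : ℝ)) →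
      |A + B + C| ≤ 48 * ((|(x : ℝ) - y| + 1) ^ 2 / 5) ^ (-((1 - s) / 2))
        + 192 * F * (m : ℝ) ^ (-(1 / 2 : ℝ)) := by
    intro A B C hA hB hC
    have := abs_add_le (A + B) C
    have := abs_add_le A B
    linarith
  refine le_of_eq_of_le (congrArg _ ?_) (e _ _ _ h3 h2 h1)
  rw [← sum_add_distrib, ← sum_add_distrib]
  refine sum_congr rfl fun k _ => ?_
  rw [show 2 * (y + 1) = 2 * y + 2 by ring]
  simp only [hφ]
  ring

/-- The gradient of the Green function up to time `T`, uniformly in the time and in the domain. -/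
theorem abs_gridGreen_sub_le_rpow (hs0 : 0 ≤ s) {ε : ℝ} (hε : 0 < ε) (hεs : s + ε < 1)
    (hM : 1 ≤ M) (hn : 1 ≤ n) {x y : ℤ} (hx : |(x : ℝ)| ≤ n) (hy : |(y : ℝ)| ≤ n) (T : ℕ) :
    |gridGreen s (liveDomain n M) (linePoint x) T (2 * (y + 1)) 0
        - gridGreen s (liveDomain n M) (linePoint x) T (2 * y) 0|
      ≤ (240 + 414720 * M ^ 2 / (s + ε)) * (1 / (|(x : ℝ) - y| + 1)) ^ (1 - s - ε) := by
  set b := s + ε with hb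
  have hb0 : 0 < b := by linarith
  have hn' : (1 : ℝ) ≤ n := by exact_mod_cast hn
  have hn0 : (0 : ℝ) < n := by linarith
  set F := 720 * M / b * (n : ℝ) ^ b with hFdef
  have hF0 : 0 ≤ F := by positivity
  have hF : ∀ T h v, gridGreen s (liveDomain n M) (linePoint x) T h v ≤ F := fun T h v =>
    gridGreen_liveDomain_le hs0 (by linarith) hb0 hεs.le (by linarith) hM hn x T h v
  set D := |(x : ℝ) - y| + 1 with hD
  have hD1 : 1 ≤ D := by have := abs_nonneg ((x : ℝ) - y); linarith
  have hDn : D ≤ 3 * n := by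
    have h1 : |(x : ℝ) - y| ≤ |(x : ℝ)| + |(y : ℝ)| := abs_sub _ _
    linarith
  have hDpow : (1 / D) ^ (1 - s - ε) = D ^ (b - 1) := by
    rw [one_div, Real.inv_rpow (by positivity), ← Real.rpow_neg (by positivity)]
    congr 1; rw [hb]; ring
  -- Since `D ≤ 3 * n`, the boundary error is at most the bulk rate up to a factor 3; `414720 = 192
  -- * 720 * 3` and `240 = 48 * 5`.
  have hnD : (n : ℝ) ^ (b - 1) ≤ 3 * D ^ (b - 1) := by
    have h1 : (n : ℝ) ^ (b - 1) ≤ (D / 3) ^ (b - 1) :=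
      Real.rpow_le_rpow_of_nonpos (by positivity) (by linarith) (by linarith)
    rw [Real.div_rpow (by positivity) (by norm_num), div_eq_mul_inv,
      ← Real.rpow_neg (by norm_num)] at h1
    have h2 : (3 : ℝ) ^ (-(b - 1)) ≤ 3 ^ (1 : ℝ) :=
      Real.rpow_le_rpow_of_exponent_le (by norm_num) (by linarith)
    rw [Real.rpow_one] at h2
    have h3 : 0 ≤ D ^ (b - 1) := by positivity
    nlinarith
  have hFn : F * M / n = 720 * M ^ 2 / b * (n : ℝ) ^ (b - 1) := by
    rw [hFdef, Real.rpow_sub_one hn0.ne']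
    field_simp
  rw [hDpow]
  have hDb : 0 ≤ D ^ (b - 1) := by positivity
  -- This case makes `m` at least one. Otherwise `n < M / 2`, and the trivial bound `F ≤ F * M / n`
  -- is already of the required form.
  by_cases hnM : M ≤ 2 * n
  · set m := ⌊(2 * (n : ℝ) / M) ^ 2⌋₊ with hm
    have hc1 : 1 ≤ (2 * (n : ℝ) / M) ^ 2 := by
      have : 1 ≤ 2 * (n : ℝ) / M := by rw [le_div_iff₀ (by linarith)]; linarith
      nlinarith
    have hm1 : 1 ≤ m := Nat.le_floor (by simpa using hc1)
    have hm1' : (1 : ℝ) ≤ m := by exact_mod_cast hm1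
    have h := abs_gridGreen_sub_le hs0 (by linarith) hM hn hF0 (by omega : 0 < m)
      (Nat.floor_le (by positivity)) x hF T y
    have hmlow : ((n : ℝ) / M) ^ 2 ≤ m := by
      have h1 := Nat.lt_floor_add_one ((2 * (n : ℝ) / M) ^ 2)
      rw [← hm] at h1
      have h2 : (2 * (n : ℝ) / M) ^ 2 = 4 * (n / M) ^ 2 := by ring
      rw [h2] at h1
      nlinarith [sq_nonneg ((n : ℝ) / M)]
    have hmpow : (m : ℝ) ^ (-(1 / 2 : ℝ)) ≤ M / n := by
      have h1 : (m : ℝ) ^ (-(1 / 2 : ℝ)) ≤ (((n : ℝ) / M) ^ 2) ^ (-(1 / 2 : ℝ)) :=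
        Real.rpow_le_rpow_of_nonpos (by positivity) hmlow (by norm_num)
      rw [← Real.rpow_natCast, ← Real.rpow_mul (by positivity),
        show ((2 : ℕ) : ℝ) * -(1 / 2 : ℝ) = -1 by norm_num, Real.rpow_neg_one, inv_div] at h1
      exact h1
    have hfirst : (D ^ 2 / 5) ^ (-((1 - s) / 2)) ≤ 5 * D ^ (b - 1) := by
      rw [Real.div_rpow (by positivity) (by norm_num), ← Real.rpow_natCast,
        ← Real.rpow_mul (by positivity), show ((2 : ℕ) : ℝ) * -((1 - s) / 2) = s - 1 by
        push_cast; ring, Real.rpow_neg (by norm_num : (0 : ℝ) ≤ 5), div_inv_eq_mul, mul_comm]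
      have h5 : (5 : ℝ) ^ ((1 - s) / 2) ≤ 5 ^ (1 : ℝ) :=
        Real.rpow_le_rpow_of_exponent_le (by norm_num) (by linarith)
      rw [Real.rpow_one] at h5
      have h6 : D ^ (s - 1) ≤ D ^ (b - 1) :=
        Real.rpow_le_rpow_of_exponent_le hD1 (by linarith)
      gcongr
    have hsecond : F * (m : ℝ) ^ (-(1 / 2 : ℝ)) ≤ 720 * M ^ 2 / b * (3 * D ^ (b - 1)) := by
      calc F * (m : ℝ) ^ (-(1 / 2 : ℝ)) ≤ F * (M / n) := by gcongr
        _ = 720 * M ^ 2 / b * (n : ℝ) ^ (b - 1) := by rw [← hFn]; ring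
        _ ≤ _ := by gcongr
    refine h.trans ?_
    have e : (240 + 414720 * M ^ 2 / b) * D ^ (b - 1) =
      48 * (5 * D ^ (b - 1)) + 192 * (720 * M ^ 2 / b * (3 * D ^ (b - 1))) := by ring
    rw [e]
    linarith
  · have h1 : |gridGreen s (liveDomain n M) (linePoint x) T (2 * (y + 1)) 0
        - gridGreen s (liveDomain n M) (linePoint x) T (2 * y) 0| ≤ F := by
      have a1 := hF T (2 * (y + 1)) 0
      have a2 := hF T (2 * y) 0
      have a3 := gridGreen_nonneg (U := liveDomain n M) hs0 (linePoint x) T (2 * (y + 1)) 0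
      have a4 := gridGreen_nonneg (U := liveDomain n M) hs0 (linePoint x) T (2 * y) 0
      rw [abs_le]; constructor <;> linarith
    have h2 : F ≤ F * M / n := by
      rw [le_div_iff₀ hn0]
      refine mul_le_mul_of_nonneg_left ?_ hF0
      linarith
    have h3 : 720 * M ^ 2 / b * (n : ℝ) ^ (b - 1) ≤ 720 * M ^ 2 / b * (3 * D ^ (b - 1)) := by
      gcongr
    have h4 : 0 ≤ M ^ 2 / b * D ^ (b - 1) := by positivity
    have e : (240 + 414720 * M ^ 2 / b) * D ^ (b - 1) =
      240 * D ^ (b - 1) + 414720 * (M ^ 2 / b * D ^ (b - 1)) := by ring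
    have e' : 720 * M ^ 2 / b * (3 * D ^ (b - 1)) = 2160 * (M ^ 2 / b * D ^ (b - 1)) := by ring
    rw [e]
    rw [e'] at h3
    rw [hFn] at h2
    linarith

/-- The bound on the Green function is uniform in the time horizon; here the exponent `b = 1` is
good enough. -/
theorem summable_survivalProb (hs0 : 0 ≤ s) (hs1 : s ≤ 1) (hM : 1 ≤ M) (hn : 1 ≤ n) (x y : ℤ) :
    Summable fun t : ℕ => survivalProb s (liveDomain n M) t (linePoint x) (linePoint y) := by
  refine summable_of_sum_range_le (c := 720 * M / 1 * (n : ℝ) ^ (1 : ℝ))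
    (fun t => survivalProb_nonneg hs0 t _ _) fun T => ?_
  have h := gridGreen_liveDomain_le hs0 hs1 one_pos le_rfl hs1 hM hn y T (2 * x) 0
  refine le_trans ?_ h
  unfold gridGreen
  rw [sum_range_succ]
  simp only [gridProb_linePoint]
  linarith [survivalProb_nonneg (U := liveDomain n M) hs0 T (linePoint x) (linePoint y)]

/-- The gradient of the Green function on the line, uniformly up to the boundary. -/
theorem abs_lineGreen_sub_le (hs0 : 0 ≤ s) {ε : ℝ} (hε : 0 < ε) (hεs : s + ε < 1)
    (hM : 1 ≤ M) (hn : 1 ≤ n) {x y : ℤ} (hx : |(x : ℝ)| ≤ n) (hy : |(y : ℝ)| ≤ n) :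
    |lineGreen s M n x (y + 1) - lineGreen s M n x y|
      ≤ (240 + 414720 * M ^ 2 / (s + ε)) * (1 / (|(x : ℝ) - y| + 1)) ^ (1 - s - ε) := by
  have hlim : ∀ z : ℤ, Filter.Tendsto
      (fun T => gridGreen s (liveDomain n M) (linePoint x) T (2 * z) 0) Filter.atTop
      (nhds (lineGreen s M n x z)) := by
    intro z
    have h := (summable_survivalProb hs0 (by linarith) hM hn x z).hasSum.tendsto_sum_nat
    have h2 := h.comp (Filter.tendsto_add_atTop_nat 1)
    refine h2.congr fun T => ?_
    simp only [Function.comp, gridGreen, gridProb_linePoint]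
    exact sum_congr rfl fun t _ => survivalProb_linePoint_comm hs0 t x z
  exact le_of_tendsto (((hlim (y + 1)).sub (hlim y)).abs)
    (Filter.Eventually.of_forall fun T => abs_gridGreen_sub_le_rpow hs0 hε hεs hM hn hx hy T)

end gradient

/-! ### Summation over the line and conclusion. -/

theorem sum_Icc_eq_range (n : ℕ) (f : ℕ → ℝ) :
    ∑ k ∈ Icc 1 n, f k = ∑ k ∈ range n, f (k + 1) := by
  rw [range_eq_Ico, sum_Ico_add' f 0 n 1]
  rfl

/-- A sum of an antitone function of the distance to an integer point of `[-n, n]`. -/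
theorem sum_Icc_natAbs_sub_le {f : ℕ → ℝ} (hf : Antitone f) (hf0 : ∀ k, 0 ≤ f k) {n : ℕ}
    (hn : 1 ≤ n) {x : ℤ} (hx : |x| ≤ n) :
    ∑ i ∈ Icc (-(n : ℤ)) n, f (x - i).natAbs ≤ 6 * ∑ k ∈ range n, f k := by
  have hx' := abs_le.1 hx
  have hmaps : ∀ i ∈ Icc (-(n : ℤ)) n, (x - i).natAbs ∈ range (3 * n) := by
    intro i hi
    rw [mem_Icc] at hi
    rw [mem_range]
    omega
  rw [← sum_fiberwise_of_maps_to hmaps]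
  have h1 : ∀ d ∈ range (3 * n), ∑ i ∈ Icc (-(n : ℤ)) n with (x - i).natAbs = d,
      f (x - i).natAbs ≤ 2 * f d := by
    intro d _
    calc ∑ i ∈ Icc (-(n : ℤ)) n with (x - i).natAbs = d, f (x - i).natAbs
        = ∑ i ∈ Icc (-(n : ℤ)) n with (x - i).natAbs = d, f d :=
          sum_congr rfl fun i hi => by rw [(mem_filter.1 hi).2]
      _ = (#{i ∈ Icc (-(n : ℤ)) n | (x - i).natAbs = d} : ℝ) * f d := by
          rw [sum_const, nsmul_eq_mul]
      _ ≤ 2 * f d := by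
          refine mul_le_mul_of_nonneg_right ?_ (hf0 d)
          have hsub : {i ∈ Icc (-(n : ℤ)) n | (x - i).natAbs = d} ⊆ {x - d, x + d} := by
            intro i hi
            have := (mem_filter.1 hi).2
            simp only [mem_insert, mem_singleton]
            omega
          exact_mod_cast (card_le_card hsub).trans card_le_two
  refine (sum_le_sum h1).trans ?_
  -- Each distance occurs at most twice and is below `3 * n`; by antitonicity each of the three
  -- blocks of length `n` is at most the first, so the factor is `2 * 3`.
  rw [← mul_sum, show 3 * n = n + n + n by ring, sum_range_add, sum_range_add]
  have h2 : ∑ k ∈ range n, f (n + k) ≤ ∑ k ∈ range n, f k :=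
    sum_le_sum fun k _ => hf (by omega)
  have h3 : ∑ k ∈ range n, f (n + n + k) ≤ ∑ k ∈ range n, f k :=
    sum_le_sum fun k _ => hf (by omega)
  linarith

end SlitWalk

theorem proposition7p1 (s δ ε M : ℝ) (hs0 : 0 ≤ s) (hs1 : s < 1) (hδ : 0 < δ) (hε : 0 < ε)
    (hM : 1 ≤ M) :
    -- the series that defines the Green function converges
    (∀ n : ℕ, 1 ≤ n → ∀ x y : ℤ,
      Summable fun t : ℕ =>
        Diamond.survivalProb s (Diamond.liveDomain n M) t
          (Diamond.linePoint x) (Diamond.linePoint y)) ∧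
    -- the gradient in the bulk
    (∃ c : ℝ, 0 < c ∧ ∀ n : ℕ, 1 ≤ n → ∀ x y : ℤ,
      |(x : ℝ)| ≤ (1 - δ) * n → |(y : ℝ)| ≤ (1 - δ / 2) * n →
      |Diamond.lineGreen s M n x (y + 1) - Diamond.lineGreen s M n x y|
        ≤ c * (1 / (|(x : ℝ) - (y : ℝ)| + 1)) ^ (1 - s - ε)) ∧
    -- the gradient near the boundary
    (∃ c : ℝ, 0 < c ∧ ∀ n : ℕ, 1 ≤ n → ∀ x y : ℤ,
      |(x : ℝ)| ≤ (1 - δ) * n → (1 - δ / 2) * n ≤ |(y : ℝ)| → |(y : ℝ)| ≤ n →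
      |Diamond.lineGreen s M n x (y + 1) - Diamond.lineGreen s M n x y|
        ≤ c * (1 / (n : ℝ)) ^ (1 - s - ε)) ∧
    -- the Dirichlet energy carried by the line
    (∃ c : ℝ, 0 < c ∧ ∀ n : ℕ, 1 ≤ n → ∀ x : ℤ, |(x : ℝ)| ≤ (1 - δ) * n →
      ∑ i ∈ Finset.Icc (-(n : ℤ)) (n : ℤ),
          (Diamond.lineGreen s M n x (i + 1) - Diamond.lineGreen s M n x i) ^ 2
        ≤ c * ∑ k ∈ Finset.Icc 1 n, 1 / (k : ℝ) ^ (2 - 2 * s - 2 * ε)) := by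
  -- It suffices to treat small exponents.
  set ε' := min ε ((1 - s) / 2) with hε'
  have hε'0 : 0 < ε' := lt_min hε (by linarith)
  have hε's : s + ε' < 1 := by have := min_le_right ε ((1 - s) / 2); linarith
  have hε'ε : ε' ≤ ε := min_le_left _ _
  have he0 : 0 < 1 - s - ε' := by linarith
  set C := 240 + 414720 * M ^ 2 / (s + ε') with hC
  have hC0 : 0 < C := by
    have : 0 < s + ε' := by linarith
    positivity
  have key : ∀ n : ℕ, 1 ≤ n → ∀ x y : ℤ, |(x : ℝ)| ≤ n → |(y : ℝ)| ≤ n →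
      |Diamond.lineGreen s M n x (y + 1) - Diamond.lineGreen s M n x y|
        ≤ C * (1 / (|(x : ℝ) - (y : ℝ)| + 1)) ^ (1 - s - ε') := fun n hn x y hx hy =>
    SlitWalk.abs_lineGreen_sub_le hs0 hε'0 hε's hM hn hx hy
  have hxn : ∀ (n : ℕ) (x : ℤ), |(x : ℝ)| ≤ (1 - δ) * n → |(x : ℝ)| ≤ n := fun n x hx => by
    have : 0 ≤ δ * n := by positivity
    linarith
  have hexp : ∀ r : ℝ, 1 ≤ r → (1 / r) ^ (1 - s - ε') ≤ (1 / r) ^ (1 - s - ε) := fun r hr =>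
    Real.rpow_le_rpow_of_exponent_ge (by positivity)
      ((div_le_one (by linarith)).2 hr) (by linarith)
  refine ⟨fun n hn x y => SlitWalk.summable_survivalProb hs0 hs1.le hM hn x y,
    ⟨C, hC0, fun n hn x y hx hy => ?_⟩, ⟨C * (2 / min δ 2) ^ (1 - s - ε'), by positivity,
      fun n hn x y hx hy hyn => ?_⟩, ⟨6 * C ^ 2, by positivity, fun n hn x hx => ?_⟩⟩
  · have hyn : |(y : ℝ)| ≤ n := by
      have : 0 ≤ δ * n := by positivity
      linarith
    refine (key n hn x y (hxn n x hx) hyn).trans (mul_le_mul_of_nonneg_left (hexp _ ?_) hC0.le)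
    linarith [abs_nonneg ((x : ℝ) - y)]
  · have hn' : (1 : ℝ) ≤ n := by exact_mod_cast hn
    refine (key n hn x y (hxn n x hx) hyn).trans ?_
    -- The points `x` and `y` are at distance at least `(1 - δ / 2) * n - (1 - δ) * n = δ / 2 * n`,
    -- so the uniform bound is already of order a power of `n`.
    have hd : min δ 2 / 2 * n ≤ |(x : ℝ) - y| + 1 := by
      have h1 := abs_sub_abs_le_abs_sub (y : ℝ) x
      rw [abs_sub_comm] at h1
      have h2 : min δ 2 / 2 * n ≤ δ / 2 * n := by
        gcongr
        exact min_le_left _ _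
      linarith
    have h3 : 1 / (|(x : ℝ) - y| + 1) ≤ 2 / min δ 2 * (1 / n) := by
      rw [div_mul_div_comm, div_le_div_iff₀ (by positivity) (by positivity)]
      linarith
    calc C * (1 / (|(x : ℝ) - y| + 1)) ^ (1 - s - ε')
        ≤ C * (2 / min δ 2 * (1 / n)) ^ (1 - s - ε') := by gcongr
      _ = C * (2 / min δ 2) ^ (1 - s - ε') * (1 / (n : ℝ)) ^ (1 - s - ε') := by
          rw [Real.mul_rpow (by positivity) (by positivity)]; ring
      _ ≤ _ := mul_le_mul_of_nonneg_left (hexp _ hn') (by positivity)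
  · have hx' : |x| ≤ (n : ℤ) := by exact_mod_cast hxn n x hx
    set f : ℕ → ℝ := fun k => (1 / ((k : ℝ) + 1)) ^ (2 * (1 - s - ε')) with hf
    have hfanti : Antitone f := fun i j hij => by
      have : (i : ℝ) ≤ j := by exact_mod_cast hij
      simp only [hf]
      gcongr
    have hf0 : ∀ k, 0 ≤ f k := fun k => by simp only [hf]; positivity
    calc ∑ i ∈ Finset.Icc (-(n : ℤ)) (n : ℤ),
          (Diamond.lineGreen s M n x (i + 1) - Diamond.lineGreen s M n x i) ^ 2
        ≤ ∑ i ∈ Finset.Icc (-(n : ℤ)) (n : ℤ), C ^ 2 * f (x - i).natAbs := by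
          refine Finset.sum_le_sum fun i hi => ?_
          have hi' : |(i : ℝ)| ≤ n := by
            have : |i| ≤ (n : ℤ) := abs_le.2 (Finset.mem_Icc.1 hi)
            exact_mod_cast this
          have h := pow_le_pow_left₀ (abs_nonneg _) (key n hn x i (hxn n x hx) hi') 2
          rw [sq_abs, mul_pow, ← Real.rpow_natCast (_ ^ (1 - s - ε')), ← Real.rpow_mul
            (by positivity)] at h
          refine h.trans (le_of_eq ?_)
          simp only [hf]
          rw [Nat.cast_natAbs]
          push_cast
          rw [mul_comm (2 : ℝ)]
      _ ≤ C ^ 2 * (6 * ∑ k ∈ Finset.range n, f k) := by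
          rw [← Finset.mul_sum]
          exact mul_le_mul_of_nonneg_left
            (SlitWalk.sum_Icc_natAbs_sub_le hfanti hf0 hn hx') (by positivity)
      _ ≤ 6 * C ^ 2 * ∑ k ∈ Finset.Icc 1 n, 1 / (k : ℝ) ^ (2 - 2 * s - 2 * ε) := by
          rw [SlitWalk.sum_Icc_eq_range, ← mul_assoc, mul_comm (C ^ 2) 6]
          refine mul_le_mul_of_nonneg_left (Finset.sum_le_sum fun k _ => ?_) (by positivity)
          have hk : (1 : ℝ) ≤ (k : ℝ) + 1 := by linarith [(Nat.cast_nonneg k : (0 : ℝ) ≤ k)]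
          simp only [hf]
          push_cast
          rw [one_div, one_div, Real.inv_rpow (by positivity)]
          refine inv_anti₀ (by positivity) ?_
          exact Real.rpow_le_rpow_of_exponent_le hk (by linarith)
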